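/- For a finite group $G$, a set $\mathcal S$ of subgroups of $G$ is said to be in general position if, for every $H\in\mathcal S$, $\bigcap_{K\in\mathcal S\setminus\{H\}}K\supsetneq\bigcap_{K\in\mathcal S}K$ (the empty intersection being $G$). Let $\mathrm{MaxDim}(G)$ be the maximum of $|\mathcal S|$ over all sets $\mathcal S$ of maximal subgroups of $G$ that are in general position. Let $p\ge 5$ be a prime and let $\mathrm{PSL}(2,p)$ be the projective special linear group of degree $2$ over the field with $p$ elements. Then $$\mathrm{MaxDim}(\mathrm{PSL}(2,p)\times\mathrm{PSL}(2,p))=2\,\mathrm{MaxDim}(\mathrm{PSL}(2,p)),$$ and moreover $\mathrm{MaxDim}(\mathrm{PSL}(2,p))\le 4$. -/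

import Mathlib

/-- A set `S` of subgroups of `G` is in general position if, for every `H ∈ S`, the intersection of
the members of `S` other than `H` strictly contains the intersection of all members of `S`.
The empty intersection is `G` itself. -/
def InGeneralPosition {G : Type*} [Group G] (S : Set (Subgroup G)) : Prop :=
  ∀ H ∈ S, sInf S < sInf (S \ {H})

/-- The maximal dimension of a finite group `G`: the largest size of a set of maximal subgroups of
`G` (coatoms of the subgroup lattice) that is in general position. -/
noncomputable def maxDim (G : Type*) [Group G] [Finite G] : ℕ :=
  sSup {n : ℕ | ∃ S : Finset (Subgroup G),
    (∀ M ∈ S, IsCoatom M) ∧ InGeneralPosition (S : Set (Subgroup G)) ∧ S.card = n}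

/-- The supremum in the definition of `maxDim` is an attained maximum. -/
theorem isGreatest_maxDim (G : Type*) [Group G] [Finite G] :
    IsGreatest {n : ℕ | ∃ S : Finset (Subgroup G),
      (∀ M ∈ S, IsCoatom M) ∧ InGeneralPosition (S : Set (Subgroup G)) ∧ S.card = n}
      (maxDim G) := by
  have hne : {n : ℕ | ∃ S : Finset (Subgroup G),
      (∀ M ∈ S, IsCoatom M) ∧ InGeneralPosition (S : Set (Subgroup G)) ∧ S.card = n}.Nonempty :=
    ⟨0, ∅, by simp, by simp [InGeneralPosition], by simp⟩
  have hbdd : BddAbove {n : ℕ | ∃ S : Finset (Subgroup G),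
      (∀ M ∈ S, IsCoatom M) ∧ InGeneralPosition (S : Set (Subgroup G)) ∧ S.card = n} := by
    have := Fintype.ofFinite (Subgroup G)
    refine ⟨Fintype.card (Subgroup G), ?_⟩
    rintro n ⟨S, -, -, rfl⟩
    exact S.card_le_univ
  exact ⟨Nat.sSup_mem hne hbdd, fun n hn => le_csSup hbdd hn⟩

/-! Write G for PSL(2, p). Pulling an optimal family of G back along both projections gives the
lower bound for G × G. For the upper bound, Goursat's lemma and the simplicity of G leave two kinds
of maximal subgroup of G × G: preimages of maximal subgroups under a projection, and graphs of
automorphisms. A family without graphs splits into two irredundant families in G. If the graph of α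
occurs, identify it with G by g ↦ (g, α g) and intersect the other members with it: they become
maximal subgroups of G, or fixed-point subgroups of nontrivial automorphisms, and stay irredundant.
So it suffices to bound irredundant families of such subgroups by 4: then the original family has at
most 5 members, and 5 ≤ 6 ≤ 2 maxDim(G), since the stabilizers of ∞, 0, 1 show maxDim(G) ≥ 3.

The bound 4 comes from the action of G on the projective line over the algebraic closure, where
every element of order prime to p other than 1 has exactly two fixed points. Each subgroup in
question is geometric (`IsGeometric`) or exceptional (`IsExceptional`). Two incomparable geometric
subgroups, neither a point stabilizer, meet in at most 4 elements. Each new member strictly shrinks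
the intersection, so only two further members can follow; and three point stabilizers already meet
trivially. Hence an all-geometric family has at most 4 members (`card_le_four_of_isGeometric`). An
exceptional subgroup has order 12, 24 or 60, by the classical orbit count for finite rotation
groups, and admits no irredundant family of four subgroups (`IsIrredundant.card_le_three`);
intersecting the other members with it again gives 4.

Fixed-point subgroups are geometric because every automorphism of G is conjugation by some M in
GL(2, p) (`exists_implements`), and what commutes with M respects its fixed points on the line. -/

/-! ### Irredundant families and the length of subgroup chains -/

/-- A family of subgroups is irredundant if no member contains the intersection of the others. -/
def IsIrredundant {ι G : Type*} [Group G] (f : ι → Subgroup G) : Prop :=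
  ∀ i, ∃ g, (∀ j, j ≠ i → g ∈ f j) ∧ g ∉ f i

theorem inGeneralPosition_iff_isIrredundant {G : Type*} [Group G] (S : Set (Subgroup G)) :
    InGeneralPosition S ↔ IsIrredundant (fun H : S => (H : Subgroup G)) := by
  constructor
  · rintro h ⟨H, hH⟩
    obtain ⟨g, hg, hg'⟩ := SetLike.exists_of_lt (h H hH)
    rw [Subgroup.mem_sInf] at hg hg'
    have key : ∀ j : S, j ≠ ⟨H, hH⟩ → g ∈ (j : Subgroup G) := fun j hj =>
      hg j ⟨j.2, fun h => hj (Subtype.ext h)⟩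
    refine ⟨g, key, fun hgH => hg' fun K hK => ?_⟩
    by_cases e : K = H
    · exact e ▸ hgH
    · exact hg K ⟨hK, e⟩
  · intro h H hH
    obtain ⟨g, hg, hg'⟩ := h ⟨H, hH⟩
    refine lt_of_le_of_ne (sInf_le_sInf Set.sdiff_subset) fun e => hg' ?_
    have : g ∈ sInf (S \ {H}) :=
      Subgroup.mem_sInf.2 fun K hK => hg ⟨K, hK.1⟩ fun h => hK.2 (congrArg Subtype.val h)
    rw [← e] at this
    exact Subgroup.mem_sInf.1 this H hH

namespace IsIrredundant

variable {ι κ G : Type*} [Group G] {f : ι → Subgroup G}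

theorem injective (h : IsIrredundant f) : Function.Injective f := by
  intro i j e
  by_contra hij
  obtain ⟨g, hg, hg'⟩ := h i
  exact hg' (e ▸ hg j (Ne.symm hij))

theorem comp_injective (h : IsIrredundant f) {e : κ → ι} (he : Function.Injective e) :
    IsIrredundant (fun k => f (e k)) := fun k => by
  obtain ⟨g, hg, hg'⟩ := h (e k)
  exact ⟨g, fun j hj => hg _ fun h => hj (he h), hg'⟩

/-- Pulling back along an injective homomorphism whose range is one of the members keeps the other
members irredundant. -/
theorem comap {H : Type*} [Group H] (h : IsIrredundant f) (φ : H →* G) (i : ι)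
    (hφ : f i ≤ φ.range) : IsIrredundant (fun j : {j // j ≠ i} => (f j).comap φ) := by
  rintro ⟨j, hj⟩
  obtain ⟨g, hg, hg'⟩ := h j
  obtain ⟨x, rfl⟩ := hφ (hg i hj.symm)
  exact ⟨x, fun k hk => hg k fun e => hk (Subtype.ext e), hg'⟩

theorem not_le_of_ne (h : IsIrredundant f) {i j : ι} (hij : i ≠ j) : ¬ f i ≤ f j := by
  obtain ⟨g, hg, hg'⟩ := h j
  exact fun hle => hg' (hle (hg i hij))

theorem not_iInf_le (h : IsIrredundant f) {s : Finset ι} {j : ι} (hj : j ∉ s) :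
    ¬ ⨅ i ∈ s, f i ≤ f j := by
  obtain ⟨g, hg, hg'⟩ := h j
  refine fun hle => hg' (hle ?_)
  simp only [Subgroup.mem_iInf]
  exact fun i hi => hg i fun e => hj (e ▸ hi)

theorem inf_not_le (h : IsIrredundant f) {i j k : ι} (hi : i ≠ k) (hj : j ≠ k) :
    ¬ f i ⊓ f j ≤ f k := by
  obtain ⟨g, hg, hg'⟩ := h k
  exact fun hle => hg' (hle ⟨hg i hi, hg j hj⟩)

end IsIrredundant

theorem Subgroup.cardFactors_lt_of_lt {G : Type*} [Group G] [Finite G] {H K : Subgroup G}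
    (h : H < K) :
    ArithmeticFunction.cardFactors (Nat.card H) < ArithmeticFunction.cardFactors (Nat.card K) := by
  obtain ⟨m, hm⟩ := Subgroup.card_dvd_of_le h.le
  have hH : Nat.card H ≠ 0 := Nat.card_pos.ne'
  have hK : Nat.card K ≠ 0 := Nat.card_pos.ne'
  have hm0 : m ≠ 0 := by rintro rfl; simp [hm] at hK
  have hm1 : m ≠ 1 := by
    rintro rfl
    exact h.ne (Subgroup.eq_of_le_of_card_ge h.le (by simp [hm]))
  rw [hm, ArithmeticFunction.cardFactors_mul hH hm0]
  have : ArithmeticFunction.cardFactors m ≠ 0 := by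
    rw [Ne, ArithmeticFunction.cardFactors_eq_zero_iff_eq_zero_or_one]
    tauto
  omega

/-- Each further member strictly shrinks the running intersection, and a strict inclusion costs at
least one prime factor of the order, counted with multiplicity. -/
theorem IsIrredundant.cardFactors_add_le {ι G : Type*} [Group G] [Finite G] [DecidableEq ι]
    {f : ι → Subgroup G} (h : IsIrredundant f) (s t : Finset ι) (hst : Disjoint s t) :
    ArithmeticFunction.cardFactors (Nat.card (⨅ i ∈ s ∪ t, f i : Subgroup G)) + t.card ≤
      ArithmeticFunction.cardFactors (Nat.card (⨅ i ∈ s, f i : Subgroup G)) := by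
  induction t using Finset.induction_on with
  | empty => simp
  | insert a t ha ih =>
    rw [Finset.disjoint_insert_right] at hst
    have ih := ih hst.2
    have hlt : (⨅ i ∈ s ∪ insert a t, f i) < (⨅ i ∈ s ∪ t, f i) := by
      have e : s ∪ insert a t = insert a (s ∪ t) := by grind
      rw [e, Finset.iInf_insert, inf_comm]
      refine lt_of_le_of_ne inf_le_left fun e => ?_
      have hle := inf_eq_left.1 e
      exact h.not_iInf_le (by simp [hst.1, ha]) hle
    have := Subgroup.cardFactors_lt_of_lt hlt
    rw [Finset.card_insert_of_notMem ha]
    omega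

theorem IsIrredundant.card_le {ι G : Type*} [Group G] [Finite G] [Fintype ι]
    {f : ι → Subgroup G} (h : IsIrredundant f) (s : Finset ι) :
    Fintype.card ι ≤
      s.card + ArithmeticFunction.cardFactors (Nat.card (⨅ i ∈ s, f i : Subgroup G)) := by
  classical
  have := h.cardFactors_add_le s sᶜ disjoint_compl_right
  rw [Finset.card_compl] at this
  have := s.card_le_univ
  omega

/-- A number at most 4 has at most two prime factors, so at most two members can follow the given
pair. -/
theorem IsIrredundant.card_le_four {ι G : Type*} [Group G] [Finite G] [Fintype ι]
    {f : ι → Subgroup G} (h : IsIrredundant f) {i j : ι} (hij : i ≠ j)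
    (hc : Nat.card (f i ⊓ f j : Subgroup G) ≤ 4) : Fintype.card ι ≤ 4 := by
  classical
  have h1 := h.card_le {i, j}
  rw [Finset.card_pair hij] at h1
  simp only [Finset.mem_insert, Finset.mem_singleton, iInf_or, iInf_inf_eq, iInf_iInf_eq_left]
    at h1
  have h2 : ArithmeticFunction.cardFactors (Nat.card (f i ⊓ f j : Subgroup G)) ≤ 2 := by
    generalize Nat.card (f i ⊓ f j : Subgroup G) = n at hc
    rw [ArithmeticFunction.cardFactors_apply]; interval_cases n <;> decide +kernel
  omega

/-! ### Finite groups whose nontrivial elements fix exactly two points -/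

/-- Every nontrivial element has exactly two fixed points. -/
def FixesExactlyTwo (E X : Type*) [Group E] [MulAction E X] : Prop :=
  ∀ g : E, g ≠ 1 → ∃ x y : X, x ≠ y ∧ ∀ z, g • z = z ↔ z = x ∨ z = y

/-- The group fixes a point or preserves a pair of points. -/
def PreservesPair (E X : Type*) [Group E] [MulAction E X] : Prop :=
  ∃ x y : X, ∀ g : E, (g • x = x ∧ g • y = y) ∨ (g • x = y ∧ g • y = x)

/-- The relation is 1/a + 1/b + 1/c = 1 + 2/n, whose left side exceeds 1. This forces a = 2 and then
b ≤ 3. The value b = 2 would give o₃ = 2, the dihedral case, excluded by `k₃`; so b = 3 and c ≤ 5.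
-/
theorem signature_cases {n a b c o₁ o₂ o₃ : ℕ} (hab : a ≤ b) (hbc : b ≤ c) (ha : 2 ≤ a)
    (h₁ : o₁ * a = n) (h₂ : o₂ * b = n) (h₃ : o₃ * c = n) (k₃ : 3 ≤ o₃)
    (hs : o₁ + o₂ + o₃ = n + 2) : n = 12 ∧ c ≤ 3 ∨ n = 24 ∧ c ≤ 4 ∨ n = 60 ∧ c ≤ 5 := by
  have ha2 : a = 2 := by
    by_contra hne
    have : 3 ≤ a := by omega
    have := Nat.mul_le_mul_left o₁ this
    have := Nat.mul_le_mul_left o₂ (show 3 ≤ b by omega)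
    have := Nat.mul_le_mul_left o₃ (show 3 ≤ c by omega)
    omega
  subst ha2
  have hb : b < 4 := by
    by_contra hne
    have := Nat.mul_le_mul_left o₂ (show 4 ≤ b by omega)
    have := Nat.mul_le_mul_left o₃ (show 4 ≤ c by omega)
    omega
  have hb' : b = 3 := by
    by_contra hne
    have : b = 2 := by omega
    subst this
    omega
  subst hb'
  have hc : c < 6 := by
    by_contra hne
    have := Nat.mul_le_mul_left o₃ (show 6 ≤ c by omega)
    omega
  interval_cases c <;> omega

theorem signature_cases_unsorted {n a b c x y z : ℕ} (ha : 2 ≤ a) (hb : 2 ≤ b) (hc : 2 ≤ c)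
    (hx : 3 ≤ x) (hy : 3 ≤ y) (hz : 3 ≤ z) (h1 : x * a = n) (h2 : y * b = n) (h3 : z * c = n)
    (hs : x + y + z = n + 2) : n = 12 ∧ a ≤ 3 ∧ b ≤ 3 ∧ c ≤ 3 ∨ n = 24 ∧ a ≤ 4 ∧ b ≤ 4 ∧ c ≤ 4 ∨
      n = 60 ∧ a ≤ 5 ∧ b ≤ 5 ∧ c ≤ 5 := by
  rcases le_total a b with h | h <;> rcases le_total b c with h' | h' <;>
    rcases le_total a c with h'' | h''
  · have := signature_cases h h' ha h1 h2 h3 hz (by omega); omega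
  · have := signature_cases h h' ha h1 h2 h3 hz (by omega); omega
  · have := signature_cases h'' h' ha h1 h3 h2 hy (by omega); omega
  · have := signature_cases h'' h hc h3 h1 h2 hy (by omega); omega
  · have := signature_cases h h'' hb h2 h1 h3 hz (by omega); omega
  · have := signature_cases h' h'' hb h2 h3 h1 hx (by omega); omega
  · have := signature_cases h' h hc h3 h2 h1 hx (by omega); omega
  · have := signature_cases h' h hc h3 h2 h1 hx (by omega); omega

theorem signature_cases_fin {n : ℕ} {o e : Fin 3 → ℕ} (he : ∀ i, 2 ≤ e i) (ho : ∀ i, 3 ≤ o i)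
    (hoe : ∀ i, o i * e i = n) (hs : ∑ i, o i = n + 2) :
    (n = 12 ∧ ∀ i, e i ≤ 3) ∨ (n = 24 ∧ ∀ i, e i ≤ 4) ∨ (n = 60 ∧ ∀ i, e i ≤ 5) := by
  have := signature_cases_unsorted (he 0) (he 1) (he 2) (ho 0) (ho 1) (ho 2) (hoe 0) (hoe 1)
    (hoe 2) (by simpa [Fin.sum_univ_three] using hs)
  simpa [Fin.forall_fin_succ] using this

-- Burnside's orbit count, as for finite groups of rotations: the lower bounds on stabilizers and
-- orbits force exactly three orbits, and the stabilizer orders then satisfy the equation of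
-- `signature_cases`.
open MulAction in
theorem card_cases_of_finite_action {E Y : Type*} [Group E] [Finite E] [MulAction E Y] [Finite Y]
    [Nonempty Y] (hfix : ∀ g : E, g ≠ 1 → Nat.card (fixedBy Y g) = 2)
    (hstab : ∀ y : Y, 2 ≤ Nat.card (stabilizer E y)) (horb : ∀ y : Y, 3 ≤ Nat.card (orbit E y)) :
    (Nat.card E = 12 ∧ ∀ y : Y, Nat.card (stabilizer E y) ≤ 3) ∨
    (Nat.card E = 24 ∧ ∀ y : Y, Nat.card (stabilizer E y) ≤ 4) ∨
    (Nat.card E = 60 ∧ ∀ y : Y, Nat.card (stabilizer E y) ≤ 5) := by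
  classical
  have := Fintype.ofFinite E
  have := Fintype.ofFinite Y
  have os : ∀ y : Y, Nat.card (orbit E y) * Nat.card (stabilizer E y) = Nat.card E := fun y => by
    simpa [Nat.card_eq_fintype_card] using card_orbit_mul_card_stabilizer_eq_card_group E y
  let o : orbitRel.Quotient E Y → ℕ := fun ω => Nat.card (orbit E ω.out)
  let e : orbitRel.Quotient E Y → ℕ := fun ω => Nat.card (stabilizer E ω.out)
  have hoe : ∀ ω, o ω * e ω = Nat.card E := fun ω => os _
  have hY : ∑ ω, o ω = Nat.card Y := by
    rw [Nat.card_congr (selfEquivSigmaOrbits E Y), Nat.card_sigma]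
  have hE : 0 < Nat.card E := Nat.card_pos
  have hB : Nat.card Y + 2 * (Nat.card E - 1) =
      Nat.card (orbitRel.Quotient E Y) * Nat.card E := by
    have h := sum_card_fixedBy_eq_card_orbits_mul_card_group E Y
    rw [← Finset.add_sum_erase _ _ (Finset.mem_univ (1 : E)),
      Finset.sum_congr rfl (g := fun _ => 2)] at h
    · simpa [Finset.card_erase_of_mem, Nat.card_eq_fintype_card, mul_comm, Fintype.card_subtype]
        using h
    · intro g hg
      rw [← Nat.card_eq_fintype_card]
      exact hfix g (Finset.ne_of_mem_erase hg)
  have ho2 : ∀ ω, 2 * o ω ≤ Nat.card E := fun ω => by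
    rw [← hoe ω, mul_comm]
    exact Nat.mul_le_mul_left _ (hstab _)
  have hY2 : 2 * Nat.card Y ≤ Nat.card (orbitRel.Quotient E Y) * Nat.card E := by
    rw [← hY, Finset.mul_sum, Nat.card_eq_fintype_card (α := orbitRel.Quotient E Y)]
    exact (Finset.sum_le_card_nsmul _ _ _ fun ω _ => ho2 ω).trans (by simp)
  have hY3 : 3 ≤ Nat.card Y := (horb (Classical.arbitrary Y)).trans
    (Nat.card_le_card_of_injective _ Subtype.val_injective)
  have hr : Nat.card (orbitRel.Quotient E Y) = 3 := by
    generalize Nat.card (orbitRel.Quotient E Y) = r at *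
    have h1 : r < 4 := by
      by_contra hne
      have := Nat.mul_le_mul_right (Nat.card E) (show 4 ≤ r by omega)
      omega
    interval_cases r <;> omega
  let q : Fin 3 ≃ orbitRel.Quotient E Y := (Finite.equivFinOfCardEq hr).symm
  have key := signature_cases_fin (n := Nat.card E) (o := fun i => o (q i)) (e := fun i => e (q i))
    (fun i => hstab _) (fun i => horb _) (fun i => hoe _)
    (by rw [Equiv.sum_comp q o, hY]; rw [hr] at hB; omega)
  have hes : ∀ y : Y, ∃ i, Nat.card (stabilizer E y) = e (q i) := fun y => by
    refine ⟨q.symm (Quotient.mk'' y), ?_⟩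
    rw [Equiv.apply_symm_apply]
    have h1 := os y
    have h2 := hoe (Quotient.mk'' y)
    have h3 : Nat.card (orbit E y) = o (Quotient.mk'' y) := by
      simp only [o]
      have : orbit E y = orbit E (Quotient.mk'' y : orbitRel.Quotient E Y).out := by
        rw [orbit_eq_iff]
        exact (orbitRel_apply.1 (Quotient.exact (Quotient.out_eq' _))) |> mem_orbit_symm.1
      rw [this]
    rw [h3, ← h2] at h1
    exact Nat.eq_of_mul_eq_mul_left (by have := horb y; omega) h1
  rcases key with ⟨h1, h2⟩ | ⟨h1, h2⟩ | ⟨h1, h2⟩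
  · exact Or.inl ⟨h1, fun y => by obtain ⟨i, hi⟩ := hes y; rw [hi]; exact h2 i⟩
  · exact Or.inr (Or.inl ⟨h1, fun y => by obtain ⟨i, hi⟩ := hes y; rw [hi]; exact h2 i⟩)
  · exact Or.inr (Or.inr ⟨h1, fun y => by obtain ⟨i, hi⟩ := hes y; rw [hi]; exact h2 i⟩)

open MulAction in
/-- A finite group in which every nontrivial element fixes exactly two points, and which preserves
no pair of points, has order 12, 24 or 60. -/
theorem card_cases_of_not_preservesPair {E X : Type*} [Group E] [Finite E] [MulAction E X]
    [Nonempty X] (hE : FixesExactlyTwo E X) (hp : ¬ PreservesPair E X) :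
    (Nat.card E = 12 ∧ ∀ x : X, Nat.card (stabilizer E x) ≤ 3) ∨
    (Nat.card E = 24 ∧ ∀ x : X, Nat.card (stabilizer E x) ≤ 4) ∨
    (Nat.card E = 60 ∧ ∀ x : X, Nat.card (stabilizer E x) ≤ 5) := by
  -- X may be infinite and have free orbits. The points fixed by some nontrivial element form a
  -- finite invariant set on which orbits can be counted.
  let Y : SubMulAction E X :=
    { carrier := {x | ∃ g : E, g ≠ 1 ∧ g • x = x}
      smul_mem' := by
        rintro h x ⟨g, hg, hx⟩
        exact ⟨h * g * h⁻¹, by simpa using hg, by simp [mul_smul, hx]⟩ }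
  have hYfix : ∀ g : E, g ≠ 1 → ∀ x : X, g • x = x → x ∈ Y := fun g hg x hx => ⟨g, hg, hx⟩
  have hfin : Finite Y := by
    have : (Y : Set X) ⊆ ⋃ g : {g : E // g ≠ 1}, {x | (g : E) • x = x} := by
      rintro x ⟨g, hg, hx⟩
      exact Set.mem_iUnion.2 ⟨⟨g, hg⟩, hx⟩
    refine Set.Finite.subset (Set.finite_iUnion fun g => ?_) this
    obtain ⟨x, y, -, h⟩ := hE g.1 g.2
    exact Set.Finite.subset (Set.toFinite {x, y}) fun z hz => (h z).1 hz
  have hnt : ∃ g : E, g ≠ 1 := by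
    by_contra! h
    obtain ⟨x⟩ := ‹Nonempty X›
    exact hp ⟨x, x, fun g => by simp [h g]⟩
  have hne : Nonempty Y := by
    obtain ⟨g, hg⟩ := hnt
    obtain ⟨x, y, -, h⟩ := hE g hg
    exact ⟨⟨x, hYfix g hg x ((h x).2 (Or.inl rfl))⟩⟩
  have key := card_cases_of_finite_action (E := E) (Y := Y) ?_ ?_ ?_
  · have hst : ∀ k, 1 ≤ k → (∀ y : Y, Nat.card (stabilizer E y) ≤ k) →
        ∀ x : X, Nat.card (stabilizer E x) ≤ k := fun k hk h x => by
      by_cases hx : x ∈ Y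
      · have := h ⟨x, hx⟩
        rwa [SubMulAction.stabilizer_of_subMul] at this
      · have : stabilizer E x = ⊥ := by
          rw [Subgroup.eq_bot_iff_forall]
          intro g hg
          by_contra hg1
          exact hx (hYfix g hg1 x hg)
        rw [this]
        simpa using hk
    rcases key with ⟨h1, h2⟩ | ⟨h1, h2⟩ | ⟨h1, h2⟩
    · exact Or.inl ⟨h1, hst 3 (by norm_num) h2⟩
    · exact Or.inr (Or.inl ⟨h1, hst 4 (by norm_num) h2⟩)
    · exact Or.inr (Or.inr ⟨h1, hst 5 (by norm_num) h2⟩)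
  · intro g hg
    obtain ⟨x, y, hxy, h⟩ := hE g hg
    have e : (Subtype.val '' (fixedBy Y g) : Set X) = {x, y} := by
      ext z
      simp only [Set.mem_image, mem_fixedBy, Set.mem_insert_iff, Set.mem_singleton_iff, ← h z]
      constructor
      · rintro ⟨w, hw, rfl⟩
        exact congrArg Subtype.val hw
      · exact fun hz => ⟨⟨z, hYfix g hg z hz⟩, Subtype.ext hz, rfl⟩
    rw [Nat.card_coe_set_eq, ← Set.ncard_image_of_injective _ Subtype.val_injective]
    erw [e]
    exact Set.ncard_pair hxy
  · rintro ⟨x, g, hg, hx⟩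
    have : Nontrivial (stabilizer E (⟨x, g, hg, hx⟩ : Y)) :=
      ⟨⟨g, Subtype.ext hx⟩, 1, fun h => hg (congrArg Subtype.val h)⟩
    exact Finite.one_lt_card
  -- An orbit with at most two points would be a preserved pair, possibly a degenerate one with y =
  -- z.
  · rintro y
    by_contra! hlt
    have hmem : ∀ g : E, g • y ∈ orbit E y := fun g => mem_orbit y g
    obtain ⟨z, hz⟩ : ∃ z : Y, orbit E y = {y, z} := by
      rw [Nat.card_coe_set_eq] at hlt
      have hpos : 0 < (orbit E y).ncard :=
        (Set.ncard_pos (Set.toFinite _)).2 ⟨y, mem_orbit_self y⟩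
      have hy := mem_orbit_self (M := E) y
      interval_cases hc : (orbit E y).ncard
      · obtain ⟨a, ha⟩ := Set.ncard_eq_one.1 hc
        rw [ha] at hy
        exact ⟨y, by rw [ha, Set.mem_singleton_iff.1 hy]; simp⟩
      · obtain ⟨a, b, -, hab⟩ := Set.ncard_eq_two.1 hc
        rw [hab] at hy
        rcases hy with rfl | rfl
        · exact ⟨b, hab⟩
        · exact ⟨a, by rw [hab, Set.pair_comm]⟩
    refine hp ⟨y, z, fun g => ?_⟩
    have h1 : g • y = y ∨ g • y = z := by simpa [hz] using hmem g
    have hzo : z ∈ orbit E y := by rw [hz]; simp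
    have h2 : g • z = y ∨ g • z = z := by
      have : g • z ∈ orbit E y := by
        obtain ⟨k, hk⟩ := hzo
        exact ⟨g * k, by simp [mul_smul, ← hk]⟩
      simpa [hz] using this
    have h3 : g • y = g • z → y = z := fun h => smul_left_cancel g h
    have c : ∀ w : Y, ((g • w : Y) : X) = g • (w : X) := fun w => rfl
    rw [← c, ← c, ← Subtype.ext_iff, ← Subtype.ext_iff, ← Subtype.ext_iff, ← Subtype.ext_iff]
    rcases h1 with h1 | h1 <;> rcases h2 with h2 | h2
    · have := h3 (h1.trans h2.symm)
      subst this
      exact Or.inl ⟨h1, h1⟩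
    · exact Or.inl ⟨h1, h2⟩
    · exact Or.inr ⟨h1, h2⟩
    · have := h3 (h1.trans h2.symm)
      subst this
      exact Or.inl ⟨h1, h1⟩

open MulAction in
theorem PreservesPair.exists_card_le {E X : Type*} [Group E] [Finite E] [MulAction E X]
    {H : Subgroup E} (h : PreservesPair H X) :
    ∃ x : X, Nat.card H ≤ 2 * Nat.card (stabilizer E x) := by
  classical
  obtain ⟨x, y, hxy⟩ := h
  refine ⟨x, ?_⟩
  have hsub : orbit H x ⊆ {x, y} := by
    rintro _ ⟨g, rfl⟩
    rcases hxy g with h | h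
    · exact Or.inl h.1
    · exact Or.inr h.1
  have hfin : (orbit H x).Finite := Set.Finite.subset (Set.toFinite _) hsub
  have := hfin.to_subtype
  have := Fintype.ofFinite H
  have := Fintype.ofFinite (orbit H x)
  have h1 : Nat.card (orbit H x) * Nat.card (stabilizer H x) = Nat.card H := by
    simpa [Nat.card_eq_fintype_card] using card_orbit_mul_card_stabilizer_eq_card_group H x
  have h2 : Nat.card (orbit H x) ≤ 2 := by
    rw [Nat.card_coe_set_eq]
    exact (Set.ncard_le_ncard hsub (Set.toFinite _)).trans ((Set.ncard_insert_le _ _).trans (by simp))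
  have h3 : Nat.card (stabilizer H x) ≤ Nat.card (stabilizer E x) :=
    Nat.card_le_card_of_injective
      (fun g : stabilizer H x => (⟨(g : H), g.2⟩ : stabilizer E x)) fun a b hab => by
        exact Subtype.ext (Subtype.ext (congrArg (fun k : stabilizer E x => (k : E)) hab))
  rw [← h1]
  exact Nat.mul_le_mul h2 h3

theorem FixesExactlyTwo.subgroup {E X : Type*} [Group E] [MulAction E X]
    (hE : FixesExactlyTwo E X) (H : Subgroup E) : FixesExactlyTwo H X := fun g hg =>
  hE (g : E) fun h => hg (Subtype.ext h)

/-- A group permutes the common fixed points of any of its normal subgroups. -/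
theorem FixesExactlyTwo.preservesPair_of_normal {E X : Type*} [Group E] [MulAction E X]
    (hE : FixesExactlyTwo E X) (c : E) (hc : c ≠ 1) (hn : (Subgroup.zpowers c).Normal) :
    PreservesPair E X := by
  obtain ⟨x, y, hxy, h⟩ := hE c hc
  have hz : ∀ z, z = x ∨ z = y → ∀ d ∈ Subgroup.zpowers c, d • z = z := fun z hz d hd =>
    (Subgroup.zpowers_le.2 (show c ∈ MulAction.stabilizer E z from (h z).2 hz)) hd
  have key : ∀ (g : E) (z : X), z = x ∨ z = y → g • z = x ∨ g • z = y := fun g z hz' => by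
    rw [← h]
    have := hz z hz' _ (hn.conj_mem c (Subgroup.mem_zpowers c) g⁻¹)
    rwa [mul_smul, mul_smul, inv_inv, inv_smul_eq_iff] at this
  refine ⟨x, y, fun g => ?_⟩
  have hinj : g • x ≠ g • y := fun e => hxy (smul_left_cancel g e)
  rcases key g x (Or.inl rfl) with h1 | h1 <;> rcases key g y (Or.inr rfl) with h2 | h2
  · exact absurd (h1.trans h2.symm) hinj
  · exact Or.inl ⟨h1, h2⟩
  · exact Or.inr ⟨h1, h2⟩
  · exact absurd (h1.trans h2.symm) hinj

/-- A subgroup of order 6 would have index 2 and so be normal. Its elements of cube 1 form a single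
subgroup of order 3, which would then be normal in E, and its two fixed points would be a preserved
pair. -/
theorem FixesExactlyTwo.card_ne_six {E X : Type*} [Group E] [Finite E] [MulAction E X]
    (hE : FixesExactlyTwo E X) (hp : ¬ PreservesPair E X) (h12 : Nat.card E = 12)
    (W : Subgroup E) : Nat.card W ≠ 6 := by
  intro h6
  have hWn : W.Normal := Subgroup.normal_of_index_eq_two (by
    have := W.card_mul_index
    rw [h6, h12] at this
    omega)
  have : Fact (Nat.Prime 3) := ⟨Nat.prime_three⟩
  obtain ⟨c, hc⟩ := exists_prime_orderOf_dvd_card' (G := W) 3 (by rw [h6]; norm_num)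
  have hC : (Subgroup.zpowers c).index = 2 := by
    have := (Subgroup.zpowers c).card_mul_index
    rw [Nat.card_zpowers, hc] at this
    omega
  -- Here x = x⁴ = (x²)², and squares lie in a subgroup of index two.
  have key : ∀ x : W, x ^ 3 = 1 → x ∈ Subgroup.zpowers c := fun x hx => by
    have h2 := (Subgroup.zpowers c).pow_mem (Subgroup.sq_mem_of_index_two hC x) 2
    rwa [← pow_mul, pow_succ x 3, hx, one_mul] at h2
  refine hp (hE.preservesPair_of_normal (c : E) ?_ ⟨fun n hn g => ?_⟩)
  · intro h
    rw [show c = 1 from Subtype.ext h, orderOf_one] at hc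
    omega
  · have hsub : ∀ x ∈ W, x ^ 3 = 1 → x ∈ Subgroup.zpowers (c : E) := fun x hx h3 => by
      obtain ⟨k, hk⟩ := key ⟨x, hx⟩ (Subtype.ext h3)
      exact ⟨k, by simpa using congrArg Subtype.val hk⟩
    have hnW : n ∈ W := (Subgroup.zpowers_le.2 c.2) hn
    refine hsub _ (hWn.conj_mem n hnW g) ?_
    obtain ⟨k, rfl⟩ := hn
    have hc3 : (c : E) ^ 3 = 1 := by
      rw [← Subgroup.coe_pow, ← hc, pow_orderOf_eq_one, Subgroup.coe_one]
    rw [conj_pow]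
    have : ((c : E) ^ k) ^ 3 = 1 := by
      rw [← zpow_natCast, ← zpow_mul, mul_comm, zpow_mul, zpow_natCast, hc3, one_zpow]
    simp [this]

/-- Otherwise V, of prime index, is its own normalizer. It is an abelian Sylow 2-subgroup, so
Burnside's transfer theorem gives a normal complement of order 3, which is cyclic and yields a
preserved pair. -/
theorem FixesExactlyTwo.normal_of_card_eq_four {E X : Type*} [Group E] [Finite E] [MulAction E X]
    (hE : FixesExactlyTwo E X) (hp : ¬ PreservesPair E X) (h12 : Nat.card E = 12)
    (V : Subgroup E) (hV : Nat.card V = 4) : V.Normal := by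
  by_contra hn
  have : Fact (Nat.Prime 2) := ⟨Nat.prime_two⟩
  have : Fact (Nat.Prime 3) := ⟨Nat.prime_three⟩
  have hind : V.index = 3 := by
    have := V.card_mul_index
    rw [hV, h12] at this
    omega
  have hnorm : Subgroup.normalizer (V : Set E) = V := by
    by_contra hne
    have h1 : V < Subgroup.normalizer (V : Set E) :=
      lt_of_le_of_ne Subgroup.le_normalizer (Ne.symm hne)
    have h3 := Subgroup.relIndex_mul_index h1.le
    rw [hind] at h3
    rcases (Nat.dvd_prime Nat.prime_three).1 ⟨_, h3.symm⟩ with h | h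
    · exact h1.not_ge (Subgroup.relIndex_eq_one.1 h)
    · rw [h] at h3
      have : (Subgroup.normalizer (V : Set E)).index = 1 := by omega
      exact hn (Subgroup.normalizer_eq_top_iff.1 (Subgroup.index_eq_one.1 this))
  let P : Sylow 2 E := IsPGroup.toSylow (P := V) (p := 2)
    (IsPGroup.of_card (p := 2) (n := 2) (by rw [hV]; norm_num)) (by rw [hind]; norm_num)
  have hcomm : ∀ a b : V, a * b = b * a := fun a b =>
    (IsPGroup.isMulCommutative_of_card_eq_prime_sq (p := 2) (by rw [hV]; norm_num)).is_comm.comm a b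
  have hPc : Subgroup.normalizer (P : Set E) ≤ Subgroup.centralizer (P : Set E) := by
    change Subgroup.normalizer (V : Set E) ≤ Subgroup.centralizer (V : Set E)
    rw [hnorm]
    intro a ha b hb
    exact congrArg Subtype.val (hcomm ⟨b, hb⟩ ⟨a, ha⟩)
  have hcompl := MonoidHom.ker_transferSylow_isComplement' P hPc
  have hcard : Nat.card (MonoidHom.transferSylow P hPc).ker = 3 := by
    have := hcompl.card_mul_card
    have hP4 : Nat.card P = 4 := hV
    rw [hP4, h12] at this
    omega
  obtain ⟨c, hc⟩ := exists_prime_orderOf_dvd_card' (G := (MonoidHom.transferSylow P hPc).ker) 3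
    (by rw [hcard])
  have hz : Subgroup.zpowers (c : E) = (MonoidHom.transferSylow P hPc).ker := by
    refine Subgroup.eq_of_le_of_card_ge (Subgroup.zpowers_le.2 c.2) ?_
    rw [Nat.card_zpowers, Subgroup.orderOf_coe, hc, hcard]
  refine hp (hE.preservesPair_of_normal (c : E) ?_ (by rw [hz]; infer_instance))
  intro h
  rw [show c = 1 from Subtype.ext h, orderOf_one] at hc
  omega

/-- For members preserving a pair, whose order is at most twice that of a point stabilizer: 8 is the
only number up to 10 with three prime factors, and it does not divide 60. -/
theorem cardFactors_eq_three_of_dvd {n m k : ℕ} (hk : k ≤ 5) (hn : n = 24 ∧ k ≤ 4 ∨ n = 60)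
    (hm : m ∣ n) (h3 : ArithmeticFunction.cardFactors m = 3) (hle : m ≤ 2 * k) :
    m = 8 ∧ n = 24 := by
  rw [ArithmeticFunction.cardFactors_apply] at h3
  have h10 : m ≤ 10 := by omega
  have : m = 8 := by
    revert h3
    clear hle hm
    interval_cases m <;> decide +kernel
  subst this
  rcases hn with hn | hn
  · exact ⟨rfl, hn.1⟩
  · rw [hn] at hm
    norm_num at hm

theorem eq_four_or_six {m n : ℕ} (hm : m ∣ n) (hn : n = 8 ∨ n = 12)
    (h2 : ArithmeticFunction.cardFactors m = 2) : m = 4 ∨ n = 12 ∧ m = 6 := by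
  rw [ArithmeticFunction.cardFactors_apply] at h2
  have h12 : m ≤ 12 := (Nat.le_of_dvd (by omega) hm).trans (by omega)
  have : m = 4 ∨ m = 6 ∨ m = 9 ∨ m = 10 := by
    revert h2
    clear hm
    interval_cases m <;> decide +kernel
  rcases hn with rfl | rfl <;> rcases this with rfl | rfl | rfl | rfl <;> revert hm <;> norm_num

/-- A finite group acting with every nontrivial element fixing exactly two points and preserving no
pair of points has no four subgroups in irredundant position. -/
theorem IsIrredundant.card_le_three {E X ι : Type*} [Group E] [Finite E] [MulAction E X]
    [Nonempty X] [Fintype ι] (hE : FixesExactlyTwo E X) (hp : ¬ PreservesPair E X)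
    {f : ι → Subgroup E} (hf : IsIrredundant f) : Fintype.card ι ≤ 3 := by
  classical
  by_contra! hcard
  obtain ⟨e⟩ : Nonempty (Fin 4 ↪ ι) :=
    Function.Embedding.nonempty_of_card_le (by rw [Fintype.card_fin]; exact hcard)
  replace hf : IsIrredundant (fun k => f (e k)) := hf.comp_injective e.injective
  generalize (fun k => f (e k)) = F at hf
  clear hcard e f
  have hΩ := hf.card_le ∅
  simp only [Finset.notMem_empty, iInf_false, iInf_top, Subgroup.card_top, Finset.card_empty,
    Fintype.card_fin, zero_add] at hΩ
  obtain ⟨k, hk5, hk, hst, hΩ4⟩ : ∃ k, k ≤ 5 ∧ (Nat.card E = 24 ∧ k ≤ 4 ∨ Nat.card E = 60) ∧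
      (∀ x : X, Nat.card (MulAction.stabilizer E x) ≤ k) ∧
      ArithmeticFunction.cardFactors (Nat.card E) = 4 := by
    have o24 : ArithmeticFunction.cardFactors 24 = 4 := by
      rw [ArithmeticFunction.cardFactors_apply]; decide +kernel
    have o60 : ArithmeticFunction.cardFactors 60 = 4 := by
      rw [ArithmeticFunction.cardFactors_apply]; decide +kernel
    have o12 : ArithmeticFunction.cardFactors 12 = 3 := by
      rw [ArithmeticFunction.cardFactors_apply]; decide +kernel
    rcases card_cases_of_not_preservesPair hE hp with ⟨h, hs⟩ | ⟨h, hs⟩ | ⟨h, hs⟩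
    · rw [h, o12] at hΩ
      omega
    · exact ⟨4, by norm_num, by omega, hs, h ▸ o24⟩
    · exact ⟨5, by norm_num, by omega, hs, h ▸ o60⟩
  have hlow := fun s => hf.card_le s
  have hup := fun s => hf.cardFactors_add_le ∅ s (Finset.disjoint_empty_left s)
  simp only [Finset.empty_union, Finset.notMem_empty, iInf_false, iInf_top, Subgroup.card_top,
    hΩ4] at hup
  -- The upper and lower bounds on lengths meet: with Ω(|E|) = 4 and four irredundant members, one
  -- member has length exactly 3 and two members meet in length exactly 2.
  have h1 : ∀ i, ArithmeticFunction.cardFactors (Nat.card (F i)) = 3 := fun i => by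
    have a := hlow {i}
    have b := hup {i}
    simp only [Finset.mem_singleton, iInf_iInf_eq_left, Finset.card_singleton,
      Fintype.card_fin] at a b
    omega
  have h2 : ∀ i j, i ≠ j →
      ArithmeticFunction.cardFactors (Nat.card (F i ⊓ F j : Subgroup E)) = 2 := fun i j hij => by
    have a := hlow {i, j}
    have b := hup {i, j}
    simp only [Finset.mem_insert, Finset.mem_singleton, iInf_or, iInf_inf_eq, iInf_iInf_eq_left,
      Finset.card_pair hij, Fintype.card_fin] at a b
    omega
  have hmax : ∀ i K, F i < K → K = ⊤ := fun i K hlt => by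
    by_contra hne
    have a := Subgroup.cardFactors_lt_of_lt hlt
    have b := Subgroup.cardFactors_lt_of_lt (lt_top_iff_ne_top.2 hne)
    rw [Subgroup.card_top, hΩ4] at b
    rw [h1] at a
    omega
  have htype : ∀ i, (Nat.card (F i) = 8 ∧ Nat.card E = 24) ∨
      (Nat.card (F i) = 12 ∧ ¬ PreservesPair (F i) X) := fun i => by
    by_cases hpi : PreservesPair (F i) X
    · obtain ⟨x, hx⟩ := hpi.exists_card_le
      exact Or.inl (cardFactors_eq_three_of_dvd hk5 hk (F i).card_subgroup_dvd_card (h1 i)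
        (hx.trans (Nat.mul_le_mul_left 2 (hst x))))
    · refine Or.inr ⟨?_, hpi⟩
      have hlt : Nat.card (F i) < Nat.card E := by
        refine lt_of_le_of_ne (Subgroup.card_le_card_group _) fun e => ?_
        have := h1 i
        rw [e, hΩ4] at this
        omega
      rcases card_cases_of_not_preservesPair (hE.subgroup (F i)) hpi with ⟨h, -⟩ | ⟨h, -⟩ | ⟨h, -⟩
      · exact h
      · have := h1 i
        rw [h] at this
        have o24 : ArithmeticFunction.cardFactors 24 = 4 := by
          rw [ArithmeticFunction.cardFactors_apply]; decide +kernel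
        omega
      · omega
  have hrel : ∀ i j, Nat.card ((F j).subgroupOf (F i)) = Nat.card (F i ⊓ F j : Subgroup E) :=
    fun i j => by
      rw [← Subgroup.inf_subgroupOf_left]
      exact Nat.card_congr (Subgroup.subgroupOfEquivOfLe inf_le_left).toEquiv
  have h4 : ∀ i j, i ≠ j → Nat.card (F i ⊓ F j : Subgroup E) = 4 := fun i j hij => by
    have h8 : Nat.card (F i) = 8 ∨ Nat.card (F i) = 12 := by
      rcases htype i with h | h
      · exact Or.inl h.1
      · exact Or.inr h.1
    rcases eq_four_or_six (Subgroup.card_dvd_of_le inf_le_left) h8 (h2 i j hij) with h | h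
    · exact h
    · rcases htype i with h' | h'
      · omega
      · refine absurd h.2 ?_
        rw [← hrel]
        exact (hE.subgroup (F i)).card_ne_six h'.2 h'.1 _
  have hnormal : ∀ i j, i ≠ j → ((F j).subgroupOf (F i)).Normal := fun i j hij => by
    rcases htype i with h | h
    · refine Subgroup.normal_of_index_eq_two ?_
      have := ((F j).subgroupOf (F i)).card_mul_index
      rw [hrel, h4 i j hij, h.1] at this
      omega
    · exact (hE.subgroup (F i)).normal_of_card_eq_four h.2 h.1 _ ((hrel i j).trans (h4 i j hij))
  have hle : ∀ i j, i ≠ j → F i ≤ Subgroup.normalizer ((F i ⊓ F j : Subgroup E) : Set E) :=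
    fun i j hij => by
      have := hnormal i j hij
      rw [← Subgroup.inf_subgroupOf_left] at this
      exact (Subgroup.normal_subgroupOf_iff_le_normalizer inf_le_left).1 this
  have h01 : (0 : Fin 4) ≠ 1 := by decide
  -- The intersection V of two members is normal in both. Members are maximal for reasons of length
  -- and distinct members are incomparable, so the normalizer of V is all of E.
  have htop : Subgroup.normalizer ((F 0 ⊓ F 1 : Subgroup E) : Set E) = ⊤ := by
    refine hmax 0 _ (lt_of_le_of_ne (hle 0 1 h01) fun e => ?_)
    have := hle 1 0 h01.symm
    rw [inf_comm, ← e] at this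
    exact hf.not_le_of_ne h01.symm this
  have hVn : (F 0 ⊓ F 1).Normal := Subgroup.normalizer_eq_top_iff.1 htop
  -- By maximality and irredundancy, F i and V generate E, so E/V is a quotient of F i.
  have hdvd : ∀ i, 0 ≠ i → 1 ≠ i → Nat.card E ∣ Nat.card (F i) * 4 := fun i h0 h1 => by
    have hsup : F i ⊔ (F 0 ⊓ F 1) = ⊤ := by
      refine hmax i _ (lt_of_le_of_ne le_sup_left fun e => hf.inf_not_le h0 h1 ?_)
      rw [e]
      exact le_sup_right
    have h := Subgroup.relIndex_sup_right (F i) (F 0 ⊓ F 1)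
    rw [hsup, Subgroup.relIndex_top_right] at h
    have h5 : (F 0 ⊓ F 1).relIndex (F i) ∣ Nat.card (F i) :=
      Subgroup.index_dvd_card _
    rw [← h] at h5
    rw [← (F 0 ⊓ F 1).card_mul_index, h4 0 1 h01, mul_comm]
    exact Nat.mul_dvd_mul_right h5 4
  have d2 := hdvd 2 (by decide) (by decide)
  have d3 := hdvd 3 (by decide) (by decide)
  have hinf := Subgroup.index_inf_le (H := F 2) (K := F 3)
  have c2 := (F 2).card_mul_index
  have c3 := (F 3).card_mul_index
  have c23 := (F 2 ⊓ F 3).card_mul_index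
  rw [h4 2 3 (by decide)] at c23
  -- Here 24 does not divide 8 · 4 and 60 does not divide 12 · 4. What remains is |E| = 24 with two
  -- members of index 2, whose intersection would have order at least 6 rather than 4.
  rcases htype 2 with t2 | t2
  · rw [t2.1, t2.2] at d2
    norm_num at d2
  · rcases htype 3 with t3 | t3
    · rw [t3.1, t3.2] at d3
      norm_num at d3
    · rcases hk with hk | hk
      · rw [t2.1, hk.1] at c2
        rw [t3.1, hk.1] at c3
        rw [hk.1] at c23
        have e2 : (F 2).index = 2 := by omega
        have e3 : (F 3).index = 2 := by omega
        rw [e2, e3] at hinf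
        omega
      · rw [t2.1, hk] at d2
        norm_num at d2

/-! ### Möbius actions and the bound four -/

open scoped Pointwise in
theorem mem_stabilizer_pair_iff {G X : Type*} [Group G] [MulAction G X] {g : G} {x y : X} :
    g ∈ MulAction.stabilizer G ({x, y} : Set X) ↔
      (g • x = x ∧ g • y = y) ∨ (g • x = y ∧ g • y = x) := by
  rw [MulAction.mem_stabilizer_iff, ← Set.image_smul, Set.image_pair, Set.pair_eq_pair_iff]

/-- The features of the action of `PSL(2, p)` on the projective line over an algebraically closed
field of characteristic `p` which are relevant to its maximal subgroups. -/
structure IsMoebiusAction (p : ℕ) (G X : Type*) [Group G] [MulAction G X] : Prop where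
  eq_one_of_three : ∀ (g : G) (x y z : X), x ≠ y → y ≠ z → x ≠ z →
    g • x = x → g • y = y → g • z = z → g = 1
  exists_two : ∀ g : G, g ^ p ≠ 1 → ∃ x y : X, x ≠ y ∧ g • x = x ∧ g • y = y
  eq_one_of_pow : ∀ (g : G) (x y : X), g ^ p = 1 → x ≠ y → g • x = x → g • y = y → g = 1
  not_preservesPair : ¬ PreservesPair G X
  exists_le_stabilizer : ∀ H : Subgroup G, H ≠ ⊤ → p ∣ Nat.card H →
    ∃ x : X, H ≤ MulAction.stabilizer G x

open scoped Pointwise in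
/-- Point stabilizers, stabilizers of unordered and of ordered pairs of points, and groups of
unipotent elements with a given fixed point. -/
def IsGeometric (p : ℕ) {G : Type*} (X : Type*) [Group G] [MulAction G X] (H : Subgroup G) : Prop :=
  (∃ x : X, H = MulAction.stabilizer G x) ∨
  (∃ x y : X, x ≠ y ∧ (H = MulAction.stabilizer G ({x, y} : Set X) ∨
    H = MulAction.stabilizer G x ⊓ MulAction.stabilizer G y)) ∨
  (∃ x : X, ∀ g, g ∈ H ↔ g • x = x ∧ g ^ p = 1)

/-- Subgroups of order prime to `p` preserving no pair of points. -/
def IsExceptional (p : ℕ) {G : Type*} (X : Type*) [Group G] [MulAction G X] (H : Subgroup G) :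
    Prop :=
  ¬ p ∣ Nat.card H ∧ ¬ PreservesPair H X

namespace IsMoebiusAction

variable {p : ℕ} {G X : Type*} [Group G] [MulAction G X]


-- An element of the intersection is determined by whether it fixes or swaps each of the two pairs:
-- two elements with the same behaviour differ by one fixing both pairs pointwise.
open scoped Pointwise in
theorem card_pair_inf_pair_le (h : IsMoebiusAction p G X) {x y z w : X} (hxy : x ≠ y)
    (hzw : z ≠ w) (hne : ({x, y} : Set X) ≠ {z, w}) :
    Nat.card (MulAction.stabilizer G ({x, y} : Set X) ⊓
      MulAction.stabilizer G ({z, w} : Set X) : Subgroup G) ≤ 4 := by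
  let φ : (MulAction.stabilizer G ({x, y} : Set X) ⊓
      MulAction.stabilizer G ({z, w} : Set X) : Subgroup G) → Prop × Prop :=
    fun g => ((g : G) • x = x, (g : G) • z = z)
  have key : ∀ (a b : G) (u v : X), u ≠ v → a ∈ MulAction.stabilizer G ({u, v} : Set X) →
      b ∈ MulAction.stabilizer G ({u, v} : Set X) → (a • u = u ↔ b • u = u) →
      (a⁻¹ * b) • u = u ∧ (a⁻¹ * b) • v = v := by
    intro a b u v huv ha hb hab
    rw [mem_stabilizer_pair_iff] at ha hb
    simp only [mul_smul, inv_smul_eq_iff]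
    rcases ha with ha | ha <;> rcases hb with hb | hb <;> simp_all
  have hφ : Function.Injective φ := by
    rintro ⟨a, ha⟩ ⟨b, hb⟩ hab
    simp only [φ, Prod.mk.injEq, eq_iff_iff] at hab
    obtain ⟨h1, h2⟩ := key a b x y hxy ha.1 hb.1 hab.1
    obtain ⟨h3, h4⟩ := key a b z w hzw ha.2 hb.2 hab.2
    have : a⁻¹ * b = 1 := by
      -- The pairs are distinct, so z or w lies outside {x, y} and supplies a third fixed point.
      by_cases hz : z = x ∨ z = y
      · have hw : w ≠ x ∧ w ≠ y := by
          constructor <;> rintro rfl <;> rcases hz with rfl | rfl <;>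
            simp_all [Set.pair_comm]
        exact h.eq_one_of_three _ x y w hxy hw.2.symm hw.1.symm h1 h2 h4
      · push Not at hz
        exact h.eq_one_of_three _ x y z hxy hz.2.symm hz.1.symm h1 h2 h3
    exact Subtype.ext (inv_mul_eq_one.1 this)
  refine (Nat.card_le_card_of_injective φ hφ).trans ?_
  simp [Nat.card_eq_fintype_card]

theorem eq_one_of_pow_of_mem_pair (h : IsMoebiusAction p G X) (hp : Odd p) {g : G} {x y : X}
    (hxy : x ≠ y) (hg : g ^ p = 1)
    (hmem : (g • x = x ∧ g • y = y) ∨ (g • x = y ∧ g • y = x)) : g = 1 := by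
  rcases hmem with hm | hm
  · exact h.eq_one_of_pow g x y hg hxy hm.1 hm.2
  · have h2 : g ^ 2 = 1 := h.eq_one_of_pow _ x y
      (by rw [← pow_mul, mul_comm, pow_mul, hg, one_pow]) hxy (by simp [sq, mul_smul, hm])
      (by simp [sq, mul_smul, hm])
    obtain ⟨k, hk⟩ := hp
    rwa [hk, pow_succ, pow_mul, h2, one_pow, one_mul] at hg

-- Distinct pairs give at most 4 common elements, while subgroups attached to the same pair are
-- comparable. A unipotent group meets each of the other non-point-stabilizer types trivially, since
-- for odd p a nontrivial unipotent preserves no pair of distinct points.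
open scoped Pointwise in
theorem card_inf_le_of_not_le [Finite G] (h : IsMoebiusAction p G X) (hp : Odd p) {H K : Subgroup G}
    (hH : IsGeometric p X H) (hK : IsGeometric p X K) (hHK : ¬ H ≤ K) (hKH : ¬ K ≤ H) :
    (∃ x : X, H = MulAction.stabilizer G x) ∨ (∃ x : X, K = MulAction.stabilizer G x) ∨
      Nat.card (H ⊓ K : Subgroup G) ≤ 4 := by
  have hle : ∀ {L : Subgroup G} {x y : X}, (L = MulAction.stabilizer G ({x, y} : Set X) ∨
      L = MulAction.stabilizer G x ⊓ MulAction.stabilizer G y) →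
      L ≤ MulAction.stabilizer G ({x, y} : Set X) := by
    rintro L x y (rfl | rfl)
    · exact le_rfl
    · exact fun g hg => mem_stabilizer_pair_iff.2 (Or.inl hg)
  have hbot : ∀ L : Subgroup G, (∀ g ∈ L, g = 1) → Nat.card L ≤ 4 := fun L hL => by
    rw [(Subgroup.eq_bot_iff_forall L).2 hL]
    simp
  rcases hH with hH | ⟨x, y, hxy, hH⟩ | ⟨x, hH⟩
  · exact Or.inl hH
  · rcases hK with hK | ⟨z, w, hzw, hK⟩ | ⟨z, hK⟩
    · exact Or.inr (Or.inl hK)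
    · refine Or.inr (Or.inr ?_)
      by_cases hne : ({x, y} : Set X) = {z, w}
      · exfalso
        have hT : MulAction.stabilizer G x ⊓ MulAction.stabilizer G y =
            MulAction.stabilizer G z ⊓ MulAction.stabilizer G w := by
          rcases Set.pair_eq_pair_iff.1 hne with ⟨rfl, rfl⟩ | ⟨rfl, rfl⟩
          · rfl
          · exact inf_comm _ _
        have hTN := hle (L := MulAction.stabilizer G z ⊓ MulAction.stabilizer G w) (Or.inr rfl)
        rw [hT, hne] at hH
        rcases hH with rfl | rfl <;> rcases hK with rfl | rfl
        · exact hHK le_rfl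
        · exact hKH hTN
        · exact hHK hTN
        · exact hHK le_rfl
      · exact (Subgroup.card_le_of_le (inf_le_inf (hle hH) (hle hK))).trans
          (h.card_pair_inf_pair_le hxy hzw hne)
    · exact Or.inr (Or.inr (hbot _ fun g hg => h.eq_one_of_pow_of_mem_pair hp hxy
        ((hK g).1 hg.2).2 (mem_stabilizer_pair_iff.1 (hle hH hg.1))))
  · rcases hK with hK | ⟨z, w, hzw, hK⟩ | ⟨z, hK⟩
    · exact Or.inr (Or.inl hK)
    · exact Or.inr (Or.inr (hbot _ fun g hg => h.eq_one_of_pow_of_mem_pair hp hzw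
        ((hH g).1 hg.1).2 (mem_stabilizer_pair_iff.1 (hle hK hg.2))))
    · refine Or.inr (Or.inr (hbot _ fun g hg => ?_))
      have hxz : x ≠ z := by
        rintro rfl
        exact hHK fun g hg => (hK g).2 ((hH g).1 hg)
      exact h.eq_one_of_pow g x z ((hH g).1 hg.1).2 hxz ((hH g).1 hg.1).1 ((hK g).1 hg.2).1

/-- If five members existed, at most one could fail to be a point stabilizer. The remaining four
point stabilizers would contradict irredundancy, since an element fixing three points is trivial. -/
theorem card_le_four_of_isGeometric [Finite G] (h : IsMoebiusAction p G X) (hp : Odd p)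
    {ι : Type*} [Fintype ι] {f : ι → Subgroup G} (hf : IsIrredundant f)
    (hgeo : ∀ i, IsGeometric p X (f i)) : Fintype.card ι ≤ 4 := by
  classical
  by_contra! hcard
  obtain ⟨i₀, hi₀⟩ : ∃ i₀, ∀ j, j ≠ i₀ → ∃ x : X, f j = MulAction.stabilizer G x := by
    by_cases hall : ∀ i, ∃ x : X, f i = MulAction.stabilizer G x
    · obtain ⟨i₀⟩ : Nonempty ι := Fintype.card_pos_iff.1 (by omega)
      exact ⟨i₀, fun j _ => hall j⟩
    · push Not at hall
      obtain ⟨i₀, hi₀⟩ := hall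
      refine ⟨i₀, fun j hj => ?_⟩
      rcases h.card_inf_le_of_not_le hp (hgeo i₀) (hgeo j) (hf.not_le_of_ne hj.symm)
        (hf.not_le_of_ne hj) with h1 | h1 | h1
      · obtain ⟨x, hx⟩ := h1
        exact absurd hx (hi₀ x)
      · exact h1
      · have := hf.card_le_four hj.symm h1
        omega
  obtain ⟨e⟩ : Nonempty (Fin 4 ↪ {j // j ≠ i₀}) :=
    Function.Embedding.nonempty_of_card_le (by
      rw [Fintype.card_fin, Fintype.card_subtype_compl, Fintype.card_subtype_eq]; omega)
  replace hf := hf.comp_injective (Subtype.val_injective.comp e.injective)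
  choose x hx using fun k => hi₀ (e k) (e k).2
  have hxinj : Function.Injective x := fun a b hab => hf.injective (by
    simp only [Function.comp_apply, hx, hab])
  obtain ⟨g, hg, hg'⟩ := hf 3
  simp only [Function.comp_apply, hx] at hg hg'
  have : g = 1 := h.eq_one_of_three g (x 0) (x 1) (x 2) (hxinj.ne (by decide))
    (hxinj.ne (by decide)) (hxinj.ne (by decide)) (hg 0 (by decide)) (hg 1 (by decide))
    (hg 2 (by decide))
  exact hg' (this ▸ one_mem _)

theorem fixesExactlyTwo [Finite G] (h : IsMoebiusAction p G X) (hp : p.Prime) {H : Subgroup G}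
    (hH : ¬ p ∣ Nat.card H) : FixesExactlyTwo H X := fun g hg => by
  have hgp : (g : G) ^ p ≠ 1 := fun e => by
    have h1 : orderOf g ∣ p := orderOf_dvd_of_pow_eq_one (Subtype.ext e)
    rcases (Nat.dvd_prime hp).1 h1 with h2 | h2
    · exact hg (orderOf_eq_one_iff.1 h2)
    · exact hH (h2 ▸ orderOf_dvd_natCard g)
  obtain ⟨x, y, hxy, hx, hy⟩ := h.exists_two _ hgp
  refine ⟨x, y, hxy, fun z => ⟨fun hz => ?_, ?_⟩⟩
  · by_contra! hne
    exact hg (Subtype.ext (h.eq_one_of_three _ x y z hxy hne.2.symm hne.1.symm hx hy hz))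
  · rintro (rfl | rfl)
    · exact hx
    · exact hy

theorem card_le_four [Finite G] [Nonempty X] (h : IsMoebiusAction p G X) (hp : p.Prime)
    (hp2 : Odd p) {ι : Type*} [Fintype ι] {f : ι → Subgroup G} (hf : IsIrredundant f)
    (htype : ∀ i, IsGeometric p X (f i) ∨ IsExceptional p X (f i)) : Fintype.card ι ≤ 4 := by
  classical
  by_cases hall : ∀ i, IsGeometric p X (f i)
  · exact h.card_le_four_of_isGeometric hp2 hf hall
  · push Not at hall
    obtain ⟨i, hi⟩ := hall
    have hE := (htype i).resolve_left hi
    have := (hf.comap (f i).subtype i (by simp)).card_le_three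
      (h.fixesExactlyTwo hp hE.1) hE.2
    rw [Fintype.card_subtype_compl, Fintype.card_subtype_eq] at this
    omega

-- Maximality turns containment in a stabilizer into equality, since the whole group preserves no
-- point and no pair.
open scoped Pointwise in
theorem isGeometric_or_isExceptional (h : IsMoebiusAction p G X) {M : Subgroup G}
    (hM : IsCoatom M) : IsGeometric p X M ∨ IsExceptional p X M := by
  have hst : ∀ x : X, M ≤ MulAction.stabilizer G x → M = MulAction.stabilizer G x :=
    fun x hx => by
      refine hx.eq_of_not_lt fun hlt => h.not_preservesPair ⟨x, x, fun g => ?_⟩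
      have hg : g ∈ MulAction.stabilizer G x := hM.2 _ hlt ▸ Subgroup.mem_top g
      exact Or.inl ⟨hg, hg⟩
  by_cases hd : p ∣ Nat.card M
  · obtain ⟨x, hx⟩ := h.exists_le_stabilizer M hM.1 hd
    exact Or.inl (Or.inl ⟨x, hst x hx⟩)
  by_cases hpair : PreservesPair M X
  · obtain ⟨x, y, hxy⟩ := hpair
    left
    by_cases e : x = y
    · subst e
      exact Or.inl ⟨x, hst x fun g hg => by simpa using hxy ⟨g, hg⟩⟩
    · refine Or.inr (Or.inl ⟨x, y, e, Or.inl ?_⟩)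
      have hle : M ≤ MulAction.stabilizer G ({x, y} : Set X) := fun g hg =>
        mem_stabilizer_pair_iff.2 (hxy ⟨g, hg⟩)
      refine hle.eq_of_not_lt fun hlt => h.not_preservesPair ⟨x, y, fun g => ?_⟩
      exact mem_stabilizer_pair_iff.1 (hM.2 _ hlt ▸ Subgroup.mem_top g)
  · exact Or.inr ⟨hd, hpair⟩

theorem maxDim_le_four [Finite G] [Nonempty X] (h : IsMoebiusAction p G X) (hp : p.Prime)
    (hp2 : Odd p) : maxDim G ≤ 4 := by
  obtain ⟨S, hS, hgen, hcard⟩ := (isGreatest_maxDim G).1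
  rw [inGeneralPosition_iff_isIrredundant] at hgen
  rw [← hcard, ← Fintype.card_coe S]
  exact h.card_le_four hp hp2 (ι := S) hgen fun i => h.isGeometric_or_isExceptional (hS i i.2)

end IsMoebiusAction

/-! ### Maximal subgroups of G × G -/

theorem IsIrredundant.card_le_maxDim {ι G : Type*} [Group G] [Finite G] [Fintype ι]
    {f : ι → Subgroup G} (hf : IsIrredundant f) (hm : ∀ i, IsCoatom (f i)) :
    Fintype.card ι ≤ maxDim G := by
  classical
  refine (isGreatest_maxDim G).2 ⟨Finset.univ.image f, ?_, ?_, ?_⟩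
  · simpa using hm
  · rw [inGeneralPosition_iff_isIrredundant]
    rintro ⟨H, hH⟩
    obtain ⟨i, -, rfl⟩ := Finset.mem_image.1 hH
    obtain ⟨g, hg, hg'⟩ := hf i
    refine ⟨g, ?_, hg'⟩
    rintro ⟨K, hK⟩ hne
    obtain ⟨j, -, rfl⟩ := Finset.mem_image.1 hK
    exact hg j fun e => hne (by subst e; rfl)
  · rw [Finset.card_image_of_injective _ hf.injective, Finset.card_univ]

/-- A maximal subgroup of the square of a simple group is the preimage of a maximal subgroup under
one of the projections, or the graph of an automorphism. -/
theorem isCoatom_prod_cases {G : Type*} [Group G] [IsSimpleGroup G] {M : Subgroup (G × G)}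
    (hM : IsCoatom M) :
    (∃ H : Subgroup G, IsCoatom H ∧ M = H.comap (MonoidHom.fst G G)) ∨
    (∃ H : Subgroup G, IsCoatom H ∧ M = H.comap (MonoidHom.snd G G)) ∨
    (∃ α : G ≃* G, M = α.toMonoidHom.graph) := by
  have hproj : ∀ φ : G × G →* G, Function.Surjective φ → M.map φ ≠ ⊤ →
      ∃ H : Subgroup G, IsCoatom H ∧ M = H.comap φ := by
    intro φ hφ hne
    have hMe : M = (M.map φ).comap φ := by
      refine (Subgroup.le_comap_map φ M).eq_of_not_lt fun hlt => hne ?_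
      have := hM.2 _ hlt
      rw [eq_top_iff]
      intro x _
      obtain ⟨y, rfl⟩ := hφ x
      exact Subgroup.mem_comap.1 (this ▸ Subgroup.mem_top y)
    refine ⟨M.map φ, ⟨hne, fun K hK => ?_⟩, hMe⟩
    have : M < K.comap φ := by
      rw [hMe]
      exact (Subgroup.comap_lt_comap_of_surjective hφ).2 hK
    have := hM.2 _ this
    rw [eq_top_iff]
    intro x _
    obtain ⟨y, rfl⟩ := hφ x
    exact Subgroup.mem_comap.1 (this ▸ Subgroup.mem_top y)
  by_cases h1 : M.map (MonoidHom.fst G G) = ⊤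
  swap
  · exact Or.inl (hproj _ Prod.fst_surjective h1)
  by_cases h2 : M.map (MonoidHom.snd G G) = ⊤
  swap
  · exact Or.inr (Or.inl (hproj _ Prod.snd_surjective h2))
  refine Or.inr (Or.inr ?_)
  have s1 : Function.Surjective (Prod.fst ∘ M.subtype) := fun x => by
    obtain ⟨y, hy, e⟩ := (h1 ▸ Subgroup.mem_top x : x ∈ M.map (MonoidHom.fst G G))
    exact ⟨⟨y, hy⟩, e⟩
  have s2 : Function.Surjective (Prod.snd ∘ M.subtype) := fun x => by
    obtain ⟨y, hy, e⟩ := (h2 ▸ Subgroup.mem_top x : x ∈ M.map (MonoidHom.snd G G))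
    exact ⟨⟨y, hy⟩, e⟩
  have n1 := Subgroup.normal_goursatFst (I := M) s1
  have n2 := Subgroup.normal_goursatSnd (I := M) s2
  -- If M contained G × 1, surjectivity onto the second factor would make M everything. Simplicity
  -- leaves only the trivial subgroup.
  have b1 : M.goursatFst = ⊥ := by
    refine n1.eq_bot_or_eq_top.resolve_right fun ht => hM.1 ?_
    rw [eq_top_iff]
    rintro ⟨x, y⟩ -
    obtain ⟨⟨⟨a, b⟩, hab⟩, e⟩ := s2 y
    simp only [Function.comp_apply, Subgroup.subtype_apply] at e
    subst e
    have : (x * a⁻¹, 1) ∈ M := Subgroup.mem_goursatFst.1 (ht ▸ Subgroup.mem_top _)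
    simpa using M.mul_mem this hab
  have b2 : M.goursatSnd = ⊥ := by
    refine n2.eq_bot_or_eq_top.resolve_right fun ht => hM.1 ?_
    rw [eq_top_iff]
    rintro ⟨x, y⟩ -
    obtain ⟨⟨⟨a, b⟩, hab⟩, e⟩ := s1 x
    simp only [Function.comp_apply, Subgroup.subtype_apply] at e
    subst e
    have : (1, y * b⁻¹) ∈ M := Subgroup.mem_goursatSnd.1 (ht ▸ Subgroup.mem_top _)
    simpa using M.mul_mem this hab
  refine Subgroup.exists_mulEquiv_eq_graph ⟨?_, s1⟩ ⟨?_, s2⟩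
  · rintro ⟨⟨a, b⟩, h⟩ ⟨⟨c, d⟩, h'⟩ e
    simp only [Function.comp_apply, Subgroup.subtype_apply] at e
    subst e
    have : b⁻¹ * d ∈ M.goursatSnd := Subgroup.mem_goursatSnd.2 (by
      simpa using M.mul_mem (M.inv_mem h) h')
    rw [b2, Subgroup.mem_bot, inv_mul_eq_one] at this
    simp [this]
  · rintro ⟨⟨a, b⟩, h⟩ ⟨⟨c, d⟩, h'⟩ e
    simp only [Function.comp_apply, Subgroup.subtype_apply] at e
    subst e
    have : a⁻¹ * c ∈ M.goursatFst := Subgroup.mem_goursatFst.2 (by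
      simpa using M.mul_mem (M.inv_mem h) h')
    rw [b1, Subgroup.mem_bot, inv_mul_eq_one] at this
    simp [this]

theorem two_mul_maxDim_le {G : Type*} [Group G] [Finite G] : 2 * maxDim G ≤ maxDim (G × G) := by
  classical
  obtain ⟨S, hS, hgen, hcard⟩ := (isGreatest_maxDim G).1
  rw [inGeneralPosition_iff_isIrredundant] at hgen
  let f : S ⊕ S → Subgroup (G × G) := Sum.elim
    (fun M => (M : Subgroup G).comap (MonoidHom.fst G G))
    (fun M => (M : Subgroup G).comap (MonoidHom.snd G G))
  have hf : IsIrredundant f := by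
    rintro (M | M)
    · obtain ⟨g, hg, hg'⟩ := hgen M
      refine ⟨(g, 1), ?_, hg'⟩
      rintro (N | N) hN
      · exact hg N fun e => hN (by rw [e])
      · exact N.1.one_mem
    · obtain ⟨g, hg, hg'⟩ := hgen M
      refine ⟨(1, g), ?_, hg'⟩
      rintro (N | N) hN
      · exact N.1.one_mem
      · exact hg N fun e => hN (by rw [e])
  have := hf.card_le_maxDim (by
    rintro (M | M)
    · exact Subgroup.isCoatom_comap_of_surjective Prod.fst_surjective (hS M M.2)
    · exact Subgroup.isCoatom_comap_of_surjective Prod.snd_surjective (hS M M.2))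
  rw [Fintype.card_sum, Fintype.card_coe, hcard] at this
  omega

/-- Maximal subgroups of `G × G` that are preimages under the projections contribute at most
`2 * maxDim G` members to an irredundant family. -/
theorem IsIrredundant.card_le_two_mul_maxDim {ι G : Type*} [Group G] [Finite G] [Fintype ι]
    {f : ι → Subgroup (G × G)} (hf : IsIrredundant f)
    (h : ∀ i, (∃ H : Subgroup G, IsCoatom H ∧ f i = H.comap (MonoidHom.fst G G)) ∨
      (∃ H : Subgroup G, IsCoatom H ∧ f i = H.comap (MonoidHom.snd G G))) :
    Fintype.card ι ≤ 2 * maxDim G := by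
  classical
  have key : ∀ (φ : G × G →* G) (P : ι → Prop),
      (∀ i, P i → ∃ H : Subgroup G, IsCoatom H ∧ f i = H.comap φ) →
      Fintype.card {i // P i} ≤ maxDim G := by
    intro φ P hP
    choose H hH hfH using fun i : {i // P i} => hP i i.2
    refine IsIrredundant.card_le_maxDim (f := H) (fun i => ?_) hH
    obtain ⟨g, hg, hg'⟩ := hf i
    refine ⟨φ g, fun j hj => ?_, fun hgi => hg' ?_⟩
    · have := hg j fun e => hj (Subtype.ext e)
      rwa [hfH] at this
    · rwa [hfH]
  -- A member is counted for the second projection only if it is not a preimage under the first, so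
  -- the two classes partition the index type.
  have k1 := key (MonoidHom.fst G G)
    (fun i => ∃ H : Subgroup G, IsCoatom H ∧ f i = H.comap (MonoidHom.fst G G)) fun i hi => hi
  have k2 := key (MonoidHom.snd G G)
    (fun i => ¬ ∃ H : Subgroup G, IsCoatom H ∧ f i = H.comap (MonoidHom.fst G G))
    fun i hi => (h i).resolve_left hi
  rw [Fintype.card_subtype_compl] at k2
  omega

/-- The subgroup of fixed points of an automorphism. -/
def MulEquiv.fixedSubgroup {G : Type*} [Group G] (γ : G ≃* G) : Subgroup G :=
  γ.toMonoidHom.eqLocus (MonoidHom.id G)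

theorem MulEquiv.mem_fixedSubgroup {G : Type*} [Group G] {γ : G ≃* G} {g : G} :
    g ∈ γ.fixedSubgroup ↔ γ g = g := Iff.rfl

theorem IsMoebiusAction.maxDim_prod {p : ℕ} {G X : Type*} [Group G] [Finite G] [IsSimpleGroup G]
    [MulAction G X] [Nonempty X] (h : IsMoebiusAction p G X) (hp : p.Prime) (hp2 : Odd p)
    (h3 : 3 ≤ maxDim G)
    (haut : ∀ γ : G ≃* G, γ ≠ MulEquiv.refl G → IsGeometric p X γ.fixedSubgroup) :
    maxDim (G × G) = 2 * maxDim G := by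
  classical
  refine le_antisymm ?_ two_mul_maxDim_le
  obtain ⟨S, hS, hgen, hcard⟩ := (isGreatest_maxDim (G × G)).1
  rw [inGeneralPosition_iff_isIrredundant] at hgen
  rw [← hcard, ← Fintype.card_coe S]
  change IsIrredundant (fun H : S => (H : Subgroup (G × G))) at hgen
  have hcases := fun i : S => isCoatom_prod_cases (hS i i.2)
  by_cases hgraph : ∃ i : S, ∃ α : G ≃* G, (i : Subgroup (G × G)) = α.toMonoidHom.graph
  swap
  · refine hgen.card_le_two_mul_maxDim fun i => ?_
    rcases hcases i with h1 | h1 | h1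
    · exact Or.inl h1
    · exact Or.inr h1
    · exact absurd ⟨i, h1⟩ hgraph
  obtain ⟨i, α, hα⟩ := hgraph
  have hirr := hgen.comap ((MonoidHom.id G).prod α.toMonoidHom) i (by
    rw [hα, MonoidHom.graph_eq_range_prod])
  have := h.card_le_four hp hp2 hirr (fun j => by
    rcases hcases j with ⟨H, hH, e⟩ | ⟨H, hH, e⟩ | ⟨β, e⟩
    · rw [e, Subgroup.comap_comap, MonoidHom.fst_comp_prod, Subgroup.comap_id]
      exact h.isGeometric_or_isExceptional hH
    · rw [e, Subgroup.comap_comap, MonoidHom.snd_comp_prod]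
      exact h.isGeometric_or_isExceptional (Subgroup.isCoatom_comap_of_surjective α.surjective hH)
    · left
      have hne : α.trans β.symm ≠ MulEquiv.refl G := fun e' => by
        refine j.2 (Subtype.ext ?_)
        rw [e, hα]
        have : α = β := by
          ext g
          have := congrArg β (DFunLike.congr_fun e' g)
          simpa using this
        rw [this]
      -- On the graph of α, the condition β g = α g of the other graph says that g is fixed by β⁻¹α.
      convert haut _ hne using 1
      ext g
      rw [MulEquiv.mem_fixedSubgroup, e, Subgroup.mem_comap, MonoidHom.mem_graph]
      simp only [MulEquiv.trans_apply, MulEquiv.symm_apply_eq]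
      exact eq_comm)
  -- The graph itself is the fifth member, and 5 ≤ 2 · 3.
  rw [Fintype.card_subtype_compl, Fintype.card_subtype_eq] at this
  omega

/-! ### Fixed points of 2 × 2 matrices as zeros of binary quadratic forms -/

section FixedPoints

variable {K : Type*} [Field K]

open Matrix

/-- The fixed points of the Möbius transformation of `A` are the zeros of a quadratic form. -/
def fixedForm (A : Matrix (Fin 2) (Fin 2) K) : OnePoint K → K
  | none => A 1 0
  | some z => A 1 0 * z ^ 2 + (A 1 1 - A 0 0) * z - A 0 1

theorem smul_eq_self_iff_fixedForm [DecidableEq K] (g : GL (Fin 2) K) (x : OnePoint K) :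
    g • x = x ↔ fixedForm (g : Matrix (Fin 2) (Fin 2) K) x = 0 := by
  cases x with
  | infty => exact OnePoint.smul_infty_eq_self_iff
  | coe z =>
    rw [← GeneralLinearGroup.fixpointPolynomial_aeval_eq_zero_iff]
    simp [fixedForm, GeneralLinearGroup.fixpointPolynomial]

theorem fixedForm_eq_zero_of_three {A : Matrix (Fin 2) (Fin 2) K} {x y z : OnePoint K}
    (hxy : x ≠ y) (hyz : y ≠ z) (hxz : x ≠ z) (hx : fixedForm A x = 0) (hy : fixedForm A y = 0)
    (hz : fixedForm A z = 0) : A 1 0 = 0 ∧ A 0 1 = 0 ∧ A 0 0 = A 1 1 := by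
  cases x <;> cases y <;> cases z <;> simp_all [fixedForm] <;> grind

/-- Two binary quadratic forms with the same two distinct zeros are proportional (`key` states that
the minors vanish). The form determines the matrix up to a scalar summand, so the matrices commute.
-/
theorem commute_of_two {A B : Matrix (Fin 2) (Fin 2) K} {x y : OnePoint K}
    (hxy : x ≠ y) (hx : fixedForm A x = 0) (hy : fixedForm A y = 0)
    (hx' : fixedForm B x = 0) (hy' : fixedForm B y = 0) : A * B = B * A := by
  have key : A 1 0 * (B 1 1 - B 0 0) = B 1 0 * (A 1 1 - A 0 0) ∧ A 1 0 * B 0 1 = B 1 0 * A 0 1 ∧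
      (A 1 1 - A 0 0) * B 0 1 = (B 1 1 - B 0 0) * A 0 1 := by
    cases x <;> cases y <;> simp_all [fixedForm] <;> grind
  ext i j
  fin_cases i <;> fin_cases j <;> simp [Matrix.mul_apply, Fin.sum_univ_two] <;> grind

/-- As for two distinct zeros, with a common double zero in their place. -/
theorem commute_of_discr_eq_zero [NeZero (2 : K)] {A B : Matrix (Fin 2) (Fin 2) K} {x : OnePoint K}
    (hx : fixedForm A x = 0) (hx' : fixedForm B x = 0) (hA : A.discr = 0) (hB : B.discr = 0) :
    A * B = B * A := by
  have h2 : (2 : K) ≠ 0 := NeZero.ne 2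
  rw [discr_fin_two, trace_fin_two, det_fin_two] at hA hB
  have key : A 1 0 * (B 1 1 - B 0 0) = B 1 0 * (A 1 1 - A 0 0) ∧ A 1 0 * B 0 1 = B 1 0 * A 0 1 ∧
      (A 1 1 - A 0 0) * B 0 1 = (B 1 1 - B 0 0) * A 0 1 := by
    cases x with
    | infty =>
      have a0 : A 1 0 = 0 := hx
      have b0 : B 1 0 = 0 := hx'
      rw [a0] at hA ⊢
      rw [b0] at hB ⊢
      have : A 1 1 - A 0 0 = 0 := by
        have : (A 1 1 - A 0 0) ^ 2 = 0 := by linear_combination hA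
        exact pow_eq_zero_iff two_ne_zero |>.1 this
      have : B 1 1 - B 0 0 = 0 := by
        have : (B 1 1 - B 0 0) ^ 2 = 0 := by linear_combination hB
        exact pow_eq_zero_iff two_ne_zero |>.1 this
      simp_all
    | coe z =>
      have a0 : A 1 0 * z ^ 2 + (A 1 1 - A 0 0) * z - A 0 1 = 0 := hx
      have b0 : B 1 0 * z ^ 2 + (B 1 1 - B 0 0) * z - B 0 1 = 0 := hx'
      have a1 : 2 * A 1 0 * z + (A 1 1 - A 0 0) = 0 := by
        have : (2 * A 1 0 * z + (A 1 1 - A 0 0)) ^ 2 = 0 := by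
          linear_combination hA + 4 * A 1 0 * a0
        exact pow_eq_zero_iff two_ne_zero |>.1 this
      have b1 : 2 * B 1 0 * z + (B 1 1 - B 0 0) = 0 := by
        have : (2 * B 1 0 * z + (B 1 1 - B 0 0)) ^ 2 = 0 := by
          linear_combination hB + 4 * B 1 0 * b0
        exact pow_eq_zero_iff two_ne_zero |>.1 this
      have e1 : A 1 1 - A 0 0 = -2 * A 1 0 * z := by linear_combination a1
      have e2 : B 1 1 - B 0 0 = -2 * B 1 0 * z := by linear_combination b1
      have e3 : A 0 1 = - A 1 0 * z ^ 2 := by linear_combination z * a1 - a0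
      have e4 : B 0 1 = - B 1 0 * z ^ 2 := by linear_combination z * b1 - b0
      rw [e1, e2, e3, e4]
      refine ⟨by ring, by ring, by ring⟩
  ext i j
  fin_cases i <;> fin_cases j <;> simp [Matrix.mul_apply, Fin.sum_univ_two] <;> grind

theorem exists_two_of_discr_ne_zero [IsAlgClosed K] [NeZero (2 : K)] {A : Matrix (Fin 2) (Fin 2) K}
    (hA : A.discr ≠ 0) : ∃ x y : OnePoint K, x ≠ y ∧ fixedForm A x = 0 ∧ fixedForm A y = 0 := by
  have h2 : (2 : K) ≠ 0 := NeZero.ne 2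
  rw [discr_fin_two, trace_fin_two, det_fin_two] at hA
  by_cases hc : A 1 0 = 0
  · rw [hc] at hA
    have hd : A 0 0 - A 1 1 ≠ 0 := fun h => hA (by linear_combination (A 0 0 - A 1 1) * h)
    refine ⟨none, some (A 0 1 / (A 1 1 - A 0 0)), OnePoint.infty_ne_coe _, hc, ?_⟩
    have hd' : A 1 1 - A 0 0 ≠ 0 := fun h => hd (by linear_combination -h)
    simp only [fixedForm, hc]
    field_simp
    ring
  · obtain ⟨s, hs⟩ := IsAlgClosed.exists_pow_nat_eq
      ((A 0 0 + A 1 1) ^ 2 - 4 * (A 0 0 * A 1 1 - A 0 1 * A 1 0)) (n := 2) (by norm_num)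
    have hs0 : s ≠ 0 := by
      rintro rfl
      exact hA (by rw [← hs]; simp)
    refine ⟨some ((A 0 0 - A 1 1 + s) / (2 * A 1 0)), some ((A 0 0 - A 1 1 - s) / (2 * A 1 0)),
      ?_, ?_, ?_⟩
    · intro h
      have := Option.some_injective _ h
      field_simp at this
      have : 2 * s = 0 := by linear_combination this
      simp_all
    · simp only [fixedForm]
      field_simp
      linear_combination hs
    · simp only [fixedForm]
      field_simp
      linear_combination hs

/-- A form of discriminant zero has at most a double root unless it vanishes identically. -/
theorem eq_of_discr_eq_zero [NeZero (2 : K)] {A : Matrix (Fin 2) (Fin 2) K} {x y : OnePoint K}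
    (hA : A.discr = 0) (hxy : x ≠ y) (hx : fixedForm A x = 0) (hy : fixedForm A y = 0) :
    A 1 0 = 0 ∧ A 0 1 = 0 ∧ A 0 0 = A 1 1 := by
  have h2 : (2 : K) ≠ 0 := NeZero.ne 2
  rw [discr_fin_two, trace_fin_two, det_fin_two] at hA
  have key : A 1 0 = 0 → A 1 1 - A 0 0 = 0 := fun h => by
    have : (A 1 1 - A 0 0) ^ 2 = 0 := by rw [h] at hA; linear_combination hA
    exact pow_eq_zero_iff two_ne_zero |>.1 this
  cases x with
  | infty =>
    cases y with
    | infty => exact absurd rfl hxy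
    | coe z =>
      have c0 : A 1 0 = 0 := hx
      have a0 : A 1 0 * z ^ 2 + (A 1 1 - A 0 0) * z - A 0 1 = 0 := hy
      have := key c0
      refine ⟨c0, ?_, ?_⟩
      · linear_combination -a0 + z ^ 2 * c0 + z * this
      · linear_combination -this
  | coe w =>
    cases y with
    | infty =>
      have c0 : A 1 0 = 0 := hy
      have a0 : A 1 0 * w ^ 2 + (A 1 1 - A 0 0) * w - A 0 1 = 0 := hx
      have := key c0
      refine ⟨c0, ?_, ?_⟩
      · linear_combination -a0 + w ^ 2 * c0 + w * this
      · linear_combination -this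
    | coe z =>
      have a0 : A 1 0 * w ^ 2 + (A 1 1 - A 0 0) * w - A 0 1 = 0 := hx
      have a1 : A 1 0 * z ^ 2 + (A 1 1 - A 0 0) * z - A 0 1 = 0 := hy
      have hwz : w - z ≠ 0 := sub_ne_zero.2 fun e => hxy (by rw [e])
      have a2 : A 1 0 * (w + z) + (A 1 1 - A 0 0) = 0 := by
        have : (w - z) * (A 1 0 * (w + z) + (A 1 1 - A 0 0)) = 0 := by
          linear_combination a0 - a1
        exact (mul_eq_zero.1 this).resolve_left hwz
      have a3 : A 1 0 = 0 := by
        have : (A 1 0 * (w - z)) ^ 2 = 0 := by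
          linear_combination hA + 4 * A 1 0 * a0 - (A 1 0 * (3 * w - z) + (A 1 1 - A 0 0)) * a2
        have := pow_eq_zero_iff two_ne_zero |>.1 this
        exact (mul_eq_zero.1 this).resolve_right hwz
      have := key a3
      refine ⟨a3, ?_, ?_⟩
      · linear_combination -a0 + w ^ 2 * a3 + w * this
      · linear_combination -this

end FixedPoints

/-! ### PSL(2, p) on the projective line over the algebraic closure -/

section PSL

open Matrix

variable {p : ℕ}

/-- The class in `PSL(2, p)` of a matrix. -/
abbrev toPSL : Matrix.SpecialLinearGroup (Fin 2) (ZMod p) →*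
    ProjectiveSpecialLinearGroup (Fin 2) (ZMod p) :=
  QuotientGroup.mk' _

theorem toPSL_surjective : Function.Surjective (toPSL (p := p)) :=
  QuotientGroup.mk'_surjective _

variable (p) [Fact p.Prime]

/-- The Möbius action of `PSL(2, p)` on the projective line over the algebraic closure, as a
homomorphism to the group of permutations. -/
noncomputable def mobiusHom : ProjectiveSpecialLinearGroup (Fin 2) (ZMod p) →*
    Equiv.Perm (OnePoint (AlgebraicClosure (ZMod p))) := by
  classical
  exact QuotientGroup.lift _ ((MulAction.toPermHom (GL (Fin 2) (AlgebraicClosure (ZMod p))) _).comp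
    (Matrix.SpecialLinearGroup.toGL.comp (Matrix.SpecialLinearGroup.map (algebraMap (ZMod p) _)))) (by
      intro g hg
      obtain ⟨r, -, hr⟩ := Matrix.SpecialLinearGroup.mem_center_iff.1 hg
      have h00 : (g : Matrix (Fin 2) (Fin 2) (ZMod p)) 0 0 = r := by rw [← hr]; simp
      have h01 : (g : Matrix (Fin 2) (Fin 2) (ZMod p)) 0 1 = 0 := by rw [← hr]; simp
      have h10 : (g : Matrix (Fin 2) (Fin 2) (ZMod p)) 1 0 = 0 := by rw [← hr]; simp
      have h11 : (g : Matrix (Fin 2) (Fin 2) (ZMod p)) 1 1 = r := by rw [← hr]; simp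
      ext1 x
      refine (smul_eq_self_iff_fixedForm _ x).2 ?_
      cases x <;> simp [fixedForm, h00, h01, h10, h11])

noncomputable instance instMulActionProjectiveLine :
    MulAction (ProjectiveSpecialLinearGroup (Fin 2) (ZMod p))
      (OnePoint (AlgebraicClosure (ZMod p))) :=
  MulAction.compHom _ (mobiusHom p)

variable {p}

theorem toPSL_smul_eq_self_iff (g : Matrix.SpecialLinearGroup (Fin 2) (ZMod p))
    (x : OnePoint (AlgebraicClosure (ZMod p))) :
    toPSL g • x = x ↔ fixedForm ((g : Matrix (Fin 2) (Fin 2) (ZMod p)).map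
      (algebraMap (ZMod p) (AlgebraicClosure (ZMod p)))) x = 0 := by
  classical
  exact smul_eq_self_iff_fixedForm (Matrix.SpecialLinearGroup.toGL
    (Matrix.SpecialLinearGroup.map (algebraMap (ZMod p) (AlgebraicClosure (ZMod p))) g)) x

theorem toPSL_eq_one_iff {g : Matrix.SpecialLinearGroup (Fin 2) (ZMod p)} :
    toPSL g = 1 ↔ g 1 0 = 0 ∧ g 0 1 = 0 ∧ g 0 0 = g 1 1 := by
  rw [QuotientGroup.mk'_apply, QuotientGroup.eq_one_iff, Matrix.SpecialLinearGroup.mem_center_iff]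
  constructor
  · rintro ⟨r, -, hr⟩
    have h00 : (g : Matrix (Fin 2) (Fin 2) (ZMod p)) 0 0 = r := by rw [← hr]; simp
    have h01 : (g : Matrix (Fin 2) (Fin 2) (ZMod p)) 0 1 = 0 := by rw [← hr]; simp
    have h10 : (g : Matrix (Fin 2) (Fin 2) (ZMod p)) 1 0 = 0 := by rw [← hr]; simp
    have h11 : (g : Matrix (Fin 2) (Fin 2) (ZMod p)) 1 1 = r := by rw [← hr]; simp
    simp [h00, h01, h10, h11]
  · rintro ⟨h1, h2, h3⟩
    have hdet := g.det_coe
    rw [det_fin_two, h1, h2, ← h3] at hdet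
    refine ⟨g 0 0, by simpa [sq] using hdet, ?_⟩
    ext i j
    fin_cases i <;> fin_cases j <;> simp [h1, h2, h3]

theorem toPSL_eq_iff {g h : Matrix.SpecialLinearGroup (Fin 2) (ZMod p)} :
    toPSL g = toPSL h ↔ g = h ∨ g = -h := by
  rw [← inv_mul_eq_one (a := toPSL g), ← map_inv, ← map_mul, toPSL_eq_one_iff]
  constructor
  · rintro ⟨h1, h2, h3⟩
    set k := g⁻¹ * h with hk
    have hdet := k.det_coe
    rw [det_fin_two, h1, h2, ← h3] at hdet
    have hkg : h = g * k := by rw [hk]; group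
    have : (k 0 0 - 1) * (k 0 0 + 1) = 0 := by linear_combination hdet
    rcases mul_eq_zero.1 this with h0 | h0
    · left
      have : k = 1 := by
        ext i j
        have e : k 0 0 = 1 := by linear_combination h0
        have e' : k 1 1 = 1 := by rw [← h3, e]
        fin_cases i <;> fin_cases j <;> simp [h1, h2, e, e']
      rw [hkg, this, mul_one]
    · right
      have : k = -1 := by
        ext i j
        have e : k 0 0 = -1 := by linear_combination h0
        have e' : k 1 1 = -1 := by rw [← h3, e]
        fin_cases i <;> fin_cases j <;> simp [h1, h2, e, e']
      rw [hkg, this]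
      simp
  · rintro (rfl | rfl)
    · simp
    · have : (-h)⁻¹ * h = -1 := by
        rw [inv_mul_eq_iff_eq_mul]; simp
      rw [this]
      simp

/-- In characteristic p, (g - r)ᵖ = gᵖ - r for r in the prime field. If gᵖ is the scalar r, then r
is an eigenvalue with r² = 1, so the trace is 2r. Conversely, discriminant zero makes g - tr(g)/2
square to zero, so gᵖ is scalar. -/
theorem toPSL_pow_eq_one_iff (hp : 5 ≤ p) {g : Matrix.SpecialLinearGroup (Fin 2) (ZMod p)} :
    toPSL g ^ p = 1 ↔ (g : Matrix (Fin 2) (Fin 2) (ZMod p)).discr = 0 := by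
  have hp' : p.Prime := Fact.out
  have h2 : (2 : ZMod p) ≠ 0 := by
    intro h
    have := (ZMod.natCast_eq_zero_iff 2 p).1 (by exact_mod_cast h)
    have := Nat.le_of_dvd (by norm_num) this
    omega
  have : NeZero (2 : ZMod p) := ⟨h2⟩
  have hdet := g.det_coe
  have frob : ∀ r : ZMod p, ((g : Matrix (Fin 2) (Fin 2) (ZMod p)) - scalar _ r) ^ p =
      (g : Matrix (Fin 2) (Fin 2) (ZMod p)) ^ p - scalar _ r := fun r => by
    rw [sub_pow_char_of_commute p (scalar_commute r (Commute.all r) _).symm,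
      ← map_pow, ZMod.pow_card]
  rw [← map_pow]
  constructor
  · intro h
    obtain ⟨r, hr, hr'⟩ := Matrix.SpecialLinearGroup.mem_center_iff.1 ((QuotientGroup.eq_one_iff _).1 h)
    have h0 := frob r
    rw [← Matrix.SpecialLinearGroup.coe_pow, ← hr', sub_self] at h0
    have h1 := congrArg det h0
    rw [det_pow, det_zero] at h1
    have h3 := pow_eq_zero_iff hp'.ne_zero |>.1 h1
    simp only [det_fin_two, Matrix.sub_apply, scalar_apply, diagonal_apply_eq, ne_eq, zero_ne_one,
      not_false_eq_true, diagonal_apply_ne, one_ne_zero, sub_zero] at h3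
    rw [det_fin_two] at hdet
    rw [Fintype.card_fin] at hr
    rw [discr_fin_two, trace_fin_two, det_fin_two]
    have : r * (g 0 0 + g 1 1) = 2 := by linear_combination hdet + hr - h3
    linear_combination (g 0 0 + g 1 1) ^ 2 * (-hr) + (r * (g 0 0 + g 1 1) + 2) * this - 4 * hdet
  · intro h
    have h0 := sub_scalar_sq_eq_discr (m := (g : Matrix (Fin 2) (Fin 2) (ZMod p)))
    rw [h, zero_div, map_zero] at h0
    have h1 := frob ((g : Matrix (Fin 2) (Fin 2) (ZMod p)).trace / 2)
    rw [pow_eq_zero_of_le (by omega) h0, eq_comm, sub_eq_zero,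
      ← Matrix.SpecialLinearGroup.coe_pow] at h1
    rw [toPSL_eq_one_iff, h1]
    simp

end PSL

/-! ### Unitriangular elements and generation -/

section PSL

open Matrix

variable {p : ℕ}

theorem Matrix.SpecialLinearGroup.ext_fin_two {R : Type*} [CommRing R]
    {g h : Matrix.SpecialLinearGroup (Fin 2) R} (h00 : g 0 0 = h 0 0) (h01 : g 0 1 = h 0 1)
    (h10 : g 1 0 = h 1 0) (h11 : g 1 1 = h 1 1) : g = h := by
  ext i j
  fin_cases i <;> fin_cases j <;> assumption

theorem Matrix.SpecialLinearGroup.mul_apply_fin_two {R : Type*} [CommRing R]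
    (g h : Matrix.SpecialLinearGroup (Fin 2) R) (i j : Fin 2) :
    (g * h) i j = g i 0 * h 0 j + g i 1 * h 1 j := by
  rw [Matrix.SpecialLinearGroup.coe_mul, Matrix.mul_apply, Fin.sum_univ_two]

theorem Matrix.SpecialLinearGroup.inv_apply_fin_two {R : Type*} [CommRing R]
    (g : Matrix.SpecialLinearGroup (Fin 2) R) : g⁻¹ 0 0 = g 1 1 ∧ g⁻¹ 0 1 = - g 0 1 ∧
      g⁻¹ 1 0 = - g 1 0 ∧ g⁻¹ 1 1 = g 0 0 := by
  rw [Matrix.SpecialLinearGroup.coe_inv, adjugate_fin_two]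
  exact ⟨rfl, rfl, rfl, rfl⟩

theorem Matrix.SpecialLinearGroup.det_eq_one_fin_two {R : Type*} [CommRing R]
    (g : Matrix.SpecialLinearGroup (Fin 2) R) : g 0 0 * g 1 1 - g 0 1 * g 1 0 = 1 := by
  rw [← det_fin_two, g.det_coe]

/-- The matrix of determinant one with the given entries. -/
def slOf {R : Type*} [CommRing R] (a b c d : R) (h : a * d - b * c = 1) :
    Matrix.SpecialLinearGroup (Fin 2) R :=
  ⟨!![a, b; c, d], by rw [det_fin_two_of, h]⟩

section

variable {R : Type*} [CommRing R] {a b c d : R} (h : a * d - b * c = 1)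

@[simp] theorem slOf_zero_zero : slOf a b c d h 0 0 = a := rfl
@[simp] theorem slOf_zero_one : slOf a b c d h 0 1 = b := rfl
@[simp] theorem slOf_one_zero : slOf a b c d h 1 0 = c := rfl
@[simp] theorem slOf_one_one : slOf a b c d h 1 1 = d := rfl

end

/-- Upper unitriangular matrices. -/
def upper (t : ZMod p) : Matrix.SpecialLinearGroup (Fin 2) (ZMod p) := slOf 1 t 0 1 (by ring)

/-- Lower unitriangular matrices. -/
def lower (t : ZMod p) : Matrix.SpecialLinearGroup (Fin 2) (ZMod p) := slOf 1 0 t 1 (by ring)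

@[simp] theorem upper_zero_zero (t : ZMod p) : upper t 0 0 = 1 := rfl
@[simp] theorem upper_zero_one (t : ZMod p) : upper t 0 1 = t := rfl
@[simp] theorem upper_one_zero (t : ZMod p) : upper t 1 0 = 0 := rfl
@[simp] theorem upper_one_one (t : ZMod p) : upper t 1 1 = 1 := rfl
@[simp] theorem lower_zero_zero (t : ZMod p) : lower t 0 0 = 1 := rfl
@[simp] theorem lower_zero_one (t : ZMod p) : lower t 0 1 = 0 := rfl
@[simp] theorem lower_one_zero (t : ZMod p) : lower t 1 0 = t := rfl
@[simp] theorem lower_one_one (t : ZMod p) : lower t 1 1 = 1 := rfl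

open Matrix.SpecialLinearGroup (ext_fin_two mul_apply_fin_two inv_apply_fin_two det_eq_one_fin_two)

theorem upper_mul (s t : ZMod p) : upper s * upper t = upper (s + t) := by
  apply ext_fin_two <;> simp [mul_apply_fin_two, add_comm]

theorem upper_pow (t : ZMod p) (n : ℕ) : upper t ^ n = upper ((n : ZMod p) * t) := by
  induction n with
  | zero => apply ext_fin_two <;> simp
  | succ n ih => rw [pow_succ, ih, upper_mul]; congr 1; push_cast; ring

theorem lower_mul (s t : ZMod p) : lower s * lower t = lower (s + t) := by
  apply ext_fin_two <;> simp [mul_apply_fin_two]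

theorem lower_pow (t : ZMod p) (n : ℕ) : lower t ^ n = lower ((n : ZMod p) * t) := by
  induction n with
  | zero => apply ext_fin_two <;> simp
  | succ n ih => rw [pow_succ, ih, lower_mul]; congr 1; push_cast; ring

variable [Fact p.Prime]

theorem eq_upper_mul_lower_mul_upper {g : Matrix.SpecialLinearGroup (Fin 2) (ZMod p)}
    (hc : g 1 0 ≠ 0) :
    g = upper ((g 0 0 - 1) / g 1 0) * lower (g 1 0) * upper ((g 1 1 - 1) / g 1 0) := by
  have hdet := det_eq_one_fin_two g
  apply ext_fin_two <;> simp [mul_apply_fin_two] <;> field_simp <;>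
    first | ring1 | linear_combination -hdet

theorem eq_top_of_upper_mem_of_lower_mem {H : Subgroup (ProjectiveSpecialLinearGroup (Fin 2) (ZMod p))}
    (hU : ∀ t, toPSL (upper t) ∈ H) (hL : ∀ t, toPSL (lower t) ∈ H) : H = ⊤ := by
  have key : ∀ g : Matrix.SpecialLinearGroup (Fin 2) (ZMod p), g 1 0 ≠ 0 → toPSL g ∈ H := by
    intro g hc
    rw [eq_upper_mul_lower_mul_upper hc, map_mul, map_mul]
    exact H.mul_mem (H.mul_mem (hU _) (hL _)) (hU _)
  rw [eq_top_iff]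
  intro x _
  obtain ⟨g, rfl⟩ := toPSL_surjective x
  by_cases hc : g 1 0 = 0
  · have ha : g 0 0 ≠ 0 := fun ha => by
      have hdet := g.det_coe
      rw [det_fin_two, hc, ha] at hdet
      simp at hdet
    have h1 := key (lower 1 * g) (by simpa [mul_apply_fin_two, hc] using ha)
    rw [map_mul] at h1
    exact (H.mul_mem_cancel_left (hL 1)).1 h1
  · exact key g hc

theorem upper_mem_of_upper_mem {H : Subgroup (ProjectiveSpecialLinearGroup (Fin 2) (ZMod p))}
    {b : ZMod p} (hb : b ≠ 0) (h : toPSL (upper b) ∈ H) (t : ZMod p) : toPSL (upper t) ∈ H := by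
  have := H.pow_mem h (t / b).val
  rwa [← map_pow, upper_pow, ZMod.natCast_zmod_val, div_mul_cancel₀ _ hb] at this

theorem lower_mem_of_lower_mem {H : Subgroup (ProjectiveSpecialLinearGroup (Fin 2) (ZMod p))}
    {b : ZMod p} (hb : b ≠ 0) (h : toPSL (lower b) ∈ H) (t : ZMod p) : toPSL (lower t) ∈ H := by
  have := H.pow_mem h (t / b).val
  rwa [← map_pow, lower_pow, ZMod.natCast_zmod_val, div_mul_cancel₀ _ hb] at this

theorem toPSL_smul_infty_iff {g : Matrix.SpecialLinearGroup (Fin 2) (ZMod p)} :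
    toPSL g • (OnePoint.infty : OnePoint (AlgebraicClosure (ZMod p))) = OnePoint.infty ↔
      g 1 0 = 0 := by
  rw [toPSL_smul_eq_self_iff]
  change algebraMap (ZMod p) (AlgebraicClosure (ZMod p)) (g 1 0) = 0 ↔ _
  simp

theorem toPSL_smul_coe_iff {g : Matrix.SpecialLinearGroup (Fin 2) (ZMod p)} {z : ZMod p} :
    toPSL g • ((algebraMap _ (AlgebraicClosure (ZMod p)) z : AlgebraicClosure (ZMod p)) :
      OnePoint (AlgebraicClosure (ZMod p))) = (algebraMap _ (AlgebraicClosure (ZMod p)) z :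
      AlgebraicClosure (ZMod p)) ↔ g 1 0 * z ^ 2 + (g 1 1 - g 0 0) * z - g 0 1 = 0 := by
  rw [toPSL_smul_eq_self_iff]
  change algebraMap (ZMod p) (AlgebraicClosure (ZMod p)) (g 1 0) * _ ^ 2 +
    (algebraMap (ZMod p) (AlgebraicClosure (ZMod p)) (g 1 1) -
      algebraMap (ZMod p) (AlgebraicClosure (ZMod p)) (g 0 0)) * _ -
    algebraMap (ZMod p) (AlgebraicClosure (ZMod p)) (g 0 1) = 0 ↔ _
  simp only [← map_pow, ← map_sub, ← map_mul, ← map_add]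
  exact map_eq_zero_iff _ (algebraMap (ZMod p) (AlgebraicClosure (ZMod p))).injective

/-- A subgroup containing a nontrivial upper unitriangular element is everything or fixes `∞`. -/
theorem eq_top_or_le_stabilizer_infty
    {H : Subgroup (ProjectiveSpecialLinearGroup (Fin 2) (ZMod p))}
    {b : ZMod p} (hb : b ≠ 0) (h : toPSL (upper b) ∈ H) : H = ⊤ ∨ H ≤ MulAction.stabilizer _
      (OnePoint.infty : OnePoint (AlgebraicClosure (ZMod p))) := by
  have hU := upper_mem_of_upper_mem hb h
  by_cases hall : ∀ g, toPSL g ∈ H → g 1 0 = 0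
  · right
    intro x hx
    obtain ⟨g, rfl⟩ := toPSL_surjective x
    exact toPSL_smul_infty_iff.2 (hall g hx)
  · left
    push Not at hall
    obtain ⟨g, hg, hc⟩ := hall
    -- Multiplying g by upper unitriangular matrices clears its diagonal. The resulting antidiagonal
    -- matrix conjugates upper unitriangular elements to lower ones.
    have hW : toPSL (upper (-(g 0 0) / g 1 0) * g * upper (-(g 1 1) / g 1 0)) ∈ H := by
      rw [map_mul, map_mul]
      exact H.mul_mem (H.mul_mem (hU _) hg) (hU _)
    refine eq_top_of_upper_mem_of_lower_mem hU fun t => ?_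
    have := H.mul_mem (H.mul_mem hW (hU (-t / (g 1 0) ^ 2))) (H.inv_mem hW)
    rw [← map_inv, ← map_mul, ← map_mul] at this
    convert this using 2
    rw [eq_mul_inv_iff_mul_eq]
    have hdet := det_eq_one_fin_two g
    have hw : upper (-(g 0 0) / g 1 0) * g * upper (-(g 1 1) / g 1 0) =
        slOf 0 (-1 / g 1 0) (g 1 0) 0 (by field_simp; ring) := by
      apply ext_fin_two <;> simp [mul_apply_fin_two] <;> field_simp
      · ring
      · linear_combination -hdet
      · ring
    rw [hw]
    apply ext_fin_two <;> (simp [mul_apply_fin_two]; try field_simp)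

theorem exists_conj_eq_upper {g : Matrix.SpecialLinearGroup (Fin 2) (ZMod p)} (h2 : (2 : ZMod p) ≠ 0)
    (hg : (g : Matrix (Fin 2) (Fin 2) (ZMod p)).discr = 0) :
    ∃ s b, toPSL (s * g * s⁻¹) = toPSL (upper b) := by
  have tri : ∀ k : Matrix.SpecialLinearGroup (Fin 2) (ZMod p), k 1 0 = 0 → k 0 0 = k 1 1 →
      ∃ b, toPSL k = toPSL (upper b) := by
    intro k h10 h00
    have hdet := k.det_coe
    rw [det_fin_two, h10, ← h00] at hdet
    have : (k 0 0 - 1) * (k 0 0 + 1) = 0 := by linear_combination hdet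
    rcases mul_eq_zero.1 this with h0 | h0
    · refine ⟨k 0 1, congrArg _ ?_⟩
      have e : k 0 0 = 1 := by linear_combination h0
      have e' : k 1 1 = 1 := by rw [← h00, e]
      apply ext_fin_two <;> simp [e, e', h10]
    · refine ⟨-k 0 1, toPSL_eq_iff.2 (Or.inr ?_)⟩
      have e : k 0 0 = -1 := by linear_combination h0
      have e' : k 1 1 = -1 := by rw [← h00, e]
      apply ext_fin_two <;> simp [e, e', h10]
  rw [discr_fin_two, trace_fin_two, det_fin_two] at hg
  by_cases hc : g 1 0 = 0
  · refine ⟨1, ?_⟩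
    simp only [one_mul, inv_one, mul_one]
    refine tri g hc ?_
    have : (g 0 0 - g 1 1) ^ 2 = 0 := by rw [hc] at hg; linear_combination hg
    exact sub_eq_zero.1 (pow_eq_zero_iff two_ne_zero |>.1 this)
  · obtain ⟨i00, i01, i10, i11⟩ := inv_apply_fin_two
      (slOf 0 1 (-1) ((g 0 0 - g 1 1) / (2 * g 1 0)) (by ring))
    -- This matrix sends the double fixed point (g₀₀ - g₁₁)/(2 g₁₀) of g to ∞.
    refine ⟨slOf 0 1 (-1) ((g 0 0 - g 1 1) / (2 * g 1 0)) (by ring), tri _ ?_ ?_⟩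
    · simp only [mul_apply_fin_two, i00, i10, slOf_one_zero, slOf_one_one]
      field_simp
      linear_combination -hg
    · simp only [mul_apply_fin_two, i00, i01, i10, i11, slOf_zero_one, slOf_one_zero, slOf_one_one,
        slOf_zero_zero]
      field_simp
      ring

end PSL

/-! ### The Möbius axioms for PSL(2, p) and three point stabilizers -/

section PSL

open Matrix

open Matrix.SpecialLinearGroup (ext_fin_two mul_apply_fin_two inv_apply_fin_two det_eq_one_fin_two)

variable {p : ℕ}

theorem ZMod.natCast_ne_zero_of_lt {n : ℕ} (hn : n ≠ 0) (hnp : n < p) : (n : ZMod p) ≠ 0 := by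
  intro h
  have := Nat.le_of_dvd (Nat.pos_of_ne_zero hn) ((ZMod.natCast_eq_zero_iff n p).1 h)
  omega

variable [Fact p.Prime]

theorem discr_map_algebraMap (g : Matrix (Fin 2) (Fin 2) (ZMod p)) :
    (g.map (algebraMap (ZMod p) (AlgebraicClosure (ZMod p)))).discr =
      algebraMap (ZMod p) (AlgebraicClosure (ZMod p)) g.discr := by
  simp only [discr_fin_two, trace_fin_two, det_fin_two, Matrix.map_apply, map_sub, map_pow,
    map_add, map_mul, map_ofNat]

theorem toPSL_eq_one_of_map {g : Matrix.SpecialLinearGroup (Fin 2) (ZMod p)}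
    (h : ((g : Matrix (Fin 2) (Fin 2) (ZMod p)).map
        (algebraMap (ZMod p) (AlgebraicClosure (ZMod p)))) 1 0 = 0 ∧
      ((g : Matrix (Fin 2) (Fin 2) (ZMod p)).map
        (algebraMap (ZMod p) (AlgebraicClosure (ZMod p)))) 0 1 = 0 ∧
      ((g : Matrix (Fin 2) (Fin 2) (ZMod p)).map
        (algebraMap (ZMod p) (AlgebraicClosure (ZMod p)))) 0 0 =
      ((g : Matrix (Fin 2) (Fin 2) (ZMod p)).map
        (algebraMap (ZMod p) (AlgebraicClosure (ZMod p)))) 1 1) : toPSL g = 1 := by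
  rw [toPSL_eq_one_iff]
  have inj := (algebraMap (ZMod p) (AlgebraicClosure (ZMod p))).injective
  exact ⟨(map_eq_zero_iff _ inj).1 h.1, (map_eq_zero_iff _ inj).1 h.2.1, inj h.2.2⟩

theorem neZero_two_of_le (hp : 5 ≤ p) : NeZero (2 : AlgebraicClosure (ZMod p)) := by
  refine ⟨fun h => ZMod.natCast_ne_zero_of_lt (p := p) (n := 2) (by norm_num) (by omega) ?_⟩
  apply (algebraMap (ZMod p) (AlgebraicClosure (ZMod p))).injective
  rw [map_natCast, map_zero]
  exact_mod_cast h

theorem upper_smul_eq_self_iff {t : ZMod p} (ht : t ≠ 0)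
    {x : OnePoint (AlgebraicClosure (ZMod p))} : toPSL (upper t) • x = x ↔ x = OnePoint.infty := by
  rw [toPSL_smul_eq_self_iff]
  have h01 := (map_ne_zero_iff _ (algebraMap (ZMod p) (AlgebraicClosure (ZMod p))).injective).2 ht
  cases x with
  | infty => exact iff_of_true (by simp [fixedForm]) rfl
  | coe z => exact iff_of_false (by simpa [fixedForm] using h01) (OnePoint.coe_ne_infty z)

/-- Passing to the algebraic closure gives every non-unipotent element two fixed points, so split
and non-split tori need no separate treatment. -/
theorem isMoebiusAction_PSL (hp : 5 ≤ p) :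
    IsMoebiusAction p (ProjectiveSpecialLinearGroup (Fin 2) (ZMod p))
      (OnePoint (AlgebraicClosure (ZMod p))) := by
  have h2 := neZero_two_of_le hp
  have hp' : p.Prime := Fact.out
  have h2' : (2 : ZMod p) ≠ 0 := by
    exact_mod_cast ZMod.natCast_ne_zero_of_lt (p := p) (n := 2) (by norm_num) (by omega)
  refine ⟨?_, ?_, ?_, ?_, ?_⟩
  · intro g x y z hxy hyz hxz hx hy hz
    obtain ⟨g, rfl⟩ := toPSL_surjective g
    rw [toPSL_smul_eq_self_iff] at hx hy hz
    exact toPSL_eq_one_of_map (fixedForm_eq_zero_of_three hxy hyz hxz hx hy hz)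
  · intro g hg
    obtain ⟨g, rfl⟩ := toPSL_surjective g
    rw [Ne, toPSL_pow_eq_one_iff hp] at hg
    obtain ⟨x, y, hxy, hx, hy⟩ := exists_two_of_discr_ne_zero
      (A := (g : Matrix (Fin 2) (Fin 2) (ZMod p)).map
        (algebraMap (ZMod p) (AlgebraicClosure (ZMod p))))
      (by rw [discr_map_algebraMap, map_ne_zero_iff _ (RingHom.injective _)]; exact hg)
    exact ⟨x, y, hxy, (toPSL_smul_eq_self_iff g x).2 hx, (toPSL_smul_eq_self_iff g y).2 hy⟩
  · intro g x y hg hxy hx hy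
    obtain ⟨g, rfl⟩ := toPSL_surjective g
    rw [toPSL_pow_eq_one_iff hp] at hg
    rw [toPSL_smul_eq_self_iff] at hx hy
    exact toPSL_eq_one_of_map
      (eq_of_discr_eq_zero (by rw [discr_map_algebraMap, hg, map_zero]) hxy hx hy)
  -- Squares fix both points of a preserved pair; the square of `upper 1` fixes only ∞, which the
  -- square of `lower 1` moves.
  · rintro ⟨x, y, h⟩
    have hu : toPSL (upper (2 : ZMod p)) • x = x := by
      have : upper (2 : ZMod p) = upper 1 * upper 1 := by rw [upper_mul]; norm_num
      rw [this, map_mul, mul_smul]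
      rcases h (toPSL (upper 1)) with h | h <;> simp only [h]
    have hl : toPSL (lower (2 : ZMod p)) • x = x := by
      have : lower (2 : ZMod p) = lower 1 * lower 1 := by rw [lower_mul]; norm_num
      rw [this, map_mul, mul_smul]
      rcases h (toPSL (lower 1)) with h | h <;> simp only [h]
    rw [(upper_smul_eq_self_iff h2').1 hu, toPSL_smul_infty_iff] at hl
    exact h2' hl
  · intro H hH hd
    obtain ⟨u, hu⟩ := exists_prime_orderOf_dvd_card' (G := H) p hd
    obtain ⟨g, hg⟩ := toPSL_surjective (u : ProjectiveSpecialLinearGroup (Fin 2) (ZMod p))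
    have hgp : toPSL g ^ p = 1 := by
      have h1 := pow_orderOf_eq_one u
      rw [hu] at h1
      rw [hg, ← Subgroup.coe_pow, h1, Subgroup.coe_one]
    obtain ⟨s, b, hsb⟩ := exists_conj_eq_upper h2' ((toPSL_pow_eq_one_iff hp).1 hgp)
    have hb : b ≠ 0 := by
      rintro rfl
      have h1 : upper (0 : ZMod p) = 1 := by apply ext_fin_two <;> simp
      rw [h1, map_mul, map_mul, map_inv, map_one, hg, conj_eq_one_iff, OneMemClass.coe_eq_one] at hsb
      rw [hsb, orderOf_one] at hu
      exact hp'.one_lt.ne hu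
    have hmem : toPSL (upper b) ∈ H.map (MulAut.conj (toPSL s)).toMonoidHom := by
      refine ⟨u, u.2, ?_⟩
      rw [← hsb, map_mul, map_mul, map_inv, hg]
      rfl
    rcases eq_top_or_le_stabilizer_infty hb hmem with h | h
    · refine absurd ?_ hH
      rw [eq_top_iff]
      intro x _
      obtain ⟨y, hy, hxy⟩ := (h ▸ Subgroup.mem_top (MulAut.conj (toPSL s) x) :
        MulAut.conj (toPSL s) x ∈ H.map (MulAut.conj (toPSL s)).toMonoidHom)
      exact (MulAut.conj (toPSL s)).injective hxy ▸ hy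
    · refine ⟨(toPSL s)⁻¹ • OnePoint.infty, fun x hx => ?_⟩
      have := h (Subgroup.mem_map_of_mem _ hx)
      rw [MulAction.mem_stabilizer_iff] at this ⊢
      simp only [MulEquiv.toMonoidHom_eq_coe, MonoidHom.coe_coe, MulAut.conj_apply,
        mul_smul] at this
      rwa [← eq_inv_smul_iff] at this

theorem isCoatom_stabilizer_infty : IsCoatom (MulAction.stabilizer
    (ProjectiveSpecialLinearGroup (Fin 2) (ZMod p))
    (OnePoint.infty : OnePoint (AlgebraicClosure (ZMod p)))) := by
  refine ⟨fun h => ?_, fun K hK => ?_⟩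
  · have h1 : toPSL (lower (1 : ZMod p)) ∈ MulAction.stabilizer
        (ProjectiveSpecialLinearGroup (Fin 2) (ZMod p))
        (OnePoint.infty : OnePoint (AlgebraicClosure (ZMod p))) := h ▸ Subgroup.mem_top _
    exact one_ne_zero (toPSL_smul_infty_iff.1 h1)
  · have h1 : toPSL (upper (1 : ZMod p)) ∈ K :=
      hK.le ((upper_smul_eq_self_iff one_ne_zero).2 rfl)
    exact (eq_top_or_le_stabilizer_infty one_ne_zero h1).resolve_right hK.not_ge

theorem isCoatom_stabilizer_smul_infty (g : ProjectiveSpecialLinearGroup (Fin 2) (ZMod p)) :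
    IsCoatom (MulAction.stabilizer (ProjectiveSpecialLinearGroup (Fin 2) (ZMod p))
      (g • OnePoint.infty : OnePoint (AlgebraicClosure (ZMod p)))) := by
  rw [MulAction.stabilizer_smul_eq_stabilizer_map_conj]
  exact ((MulAut.conj g).mapSubgroup.isCoatom_iff _).2 isCoatom_stabilizer_infty

/-- `PSL(2, p)` is transitive on the rational points of the projective line. -/
theorem exists_smul_infty_eq (z : ZMod p) : ∃ g : ProjectiveSpecialLinearGroup (Fin 2) (ZMod p),
    g • (OnePoint.infty : OnePoint (AlgebraicClosure (ZMod p))) =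
      (algebraMap _ (AlgebraicClosure (ZMod p)) z : AlgebraicClosure (ZMod p)) := by
  classical
  refine ⟨toPSL (slOf z (-1) 1 0 (by ring)), ?_⟩
  refine (OnePoint.smul_infty_eq_ite (Matrix.SpecialLinearGroup.toGL
    (Matrix.SpecialLinearGroup.map (algebraMap (ZMod p) (AlgebraicClosure (ZMod p)))
      (slOf z (-1) 1 0 (by ring))))).trans ?_
  simp

theorem three_le_maxDim_PSL (hp : 5 ≤ p) :
    3 ≤ maxDim (ProjectiveSpecialLinearGroup (Fin 2) (ZMod p)) := by
  have h2 : (2 : ZMod p) ≠ 0 := by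
    exact_mod_cast ZMod.natCast_ne_zero_of_lt (p := p) (n := 2) (by norm_num) (by omega)
  have h3 : (3 : ZMod p) ≠ 0 := by
    exact_mod_cast ZMod.natCast_ne_zero_of_lt (p := p) (n := 3) (by norm_num) (by omega)
  obtain ⟨a, ha⟩ := exists_smul_infty_eq (0 : ZMod p)
  obtain ⟨b, hb⟩ := exists_smul_infty_eq (1 : ZMod p)
  let x : Fin 3 → OnePoint (AlgebraicClosure (ZMod p)) :=
    ![OnePoint.infty, a • OnePoint.infty, b • OnePoint.infty]
  have e0 : ∀ g : Matrix.SpecialLinearGroup (Fin 2) (ZMod p),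
      toPSL g ∈ MulAction.stabilizer _ (x 0) ↔ g 1 0 = 0 := fun g => toPSL_smul_infty_iff
  have e1 : ∀ g : Matrix.SpecialLinearGroup (Fin 2) (ZMod p),
      toPSL g ∈ MulAction.stabilizer _ (x 1) ↔ g 0 1 = 0 := fun g => by
    rw [show x 1 = _ from ha, MulAction.mem_stabilizer_iff, toPSL_smul_coe_iff]
    simp
  have e2 : ∀ g : Matrix.SpecialLinearGroup (Fin 2) (ZMod p),
      toPSL g ∈ MulAction.stabilizer _ (x 2) ↔ g 1 0 + (g 1 1 - g 0 0) - g 0 1 = 0 := fun g => by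
    rw [show x 2 = _ from hb, MulAction.mem_stabilizer_iff, toPSL_smul_coe_iff]
    simp
  have key : IsIrredundant (fun i => MulAction.stabilizer
      (ProjectiveSpecialLinearGroup (Fin 2) (ZMod p)) (x i)) := by
    simp only [IsIrredundant, Fin.forall_fin_succ, IsEmpty.forall_iff]
    -- Each witness fixes exactly two of ∞, 0, 1. The last is z ↦ 4z, which moves 1 because 3 ≠ 0;
    -- the others are its analogues for the other two pairs.
    refine ⟨⟨toPSL (slOf 2 0 (3 / 2) (1 / 2) (by field_simp; ring)), ?_⟩,
      ⟨toPSL (slOf 2 (-3 / 2) 0 (1 / 2) (by field_simp; ring)), ?_⟩,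
      ⟨toPSL (slOf 2 0 0 (1 / 2) (by field_simp; ring)), ?_⟩, trivial⟩
    · simp only [Fin.succ_zero_eq_one, Fin.succ_one_eq_two, e0, e1, e2]
      simp [h2, h3]
      field_simp
      ring
    · simp only [Fin.succ_zero_eq_one, Fin.succ_one_eq_two, e0, e1, e2]
      simp [h2, h3]
      field_simp
      ring
    · simp only [Fin.succ_zero_eq_one, Fin.succ_one_eq_two, e0, e1, e2]
      simp
      intro h
      apply h3
      field_simp at h
      linear_combination -h
  have := key.card_le_maxDim (fun i => by
    fin_cases i
    · exact isCoatom_stabilizer_infty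
    · exact isCoatom_stabilizer_smul_infty a
    · exact isCoatom_stabilizer_smul_infty b)
  simpa using this

end PSL

/-! ### Simplicity of PSL(2, p) -/

section PSL

open Matrix

open Matrix.SpecialLinearGroup (ext_fin_two mul_apply_fin_two inv_apply_fin_two det_eq_one_fin_two)

variable {p : ℕ} [Fact p.Prime]

/-- A normal subgroup fixing x fixes the whole orbit of x, which contains the three distinct points
x, hx, h²x. -/
theorem eq_bot_of_normal_of_le_stabilizer (hp : 5 ≤ p)
    {N : Subgroup (ProjectiveSpecialLinearGroup (Fin 2) (ZMod p))} (hN : N.Normal)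
    {x : OnePoint (AlgebraicClosure (ZMod p))} (hx : N ≤ MulAction.stabilizer _ x) : N = ⊥ := by
  have h2 : (2 : ZMod p) ≠ 0 := by
    exact_mod_cast ZMod.natCast_ne_zero_of_lt (p := p) (n := 2) (by norm_num) (by omega)
  obtain ⟨h, h1, h2⟩ : ∃ h : ProjectiveSpecialLinearGroup (Fin 2) (ZMod p),
      h • x ≠ x ∧ (h * h) • x ≠ x := by
    by_cases e : x = OnePoint.infty
    · subst e
      refine ⟨toPSL (lower 1), ?_, ?_⟩
      · rw [Ne, toPSL_smul_infty_iff]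
        exact one_ne_zero
      · rw [← map_mul, lower_mul, Ne, toPSL_smul_infty_iff, one_add_one_eq_two]
        exact h2
    · refine ⟨toPSL (upper 1), ?_, ?_⟩
      · rwa [Ne, upper_smul_eq_self_iff one_ne_zero]
      · rwa [← map_mul, upper_mul, one_add_one_eq_two, Ne, upper_smul_eq_self_iff h2]
  have key : ∀ g ∈ N, ∀ k : ProjectiveSpecialLinearGroup (Fin 2) (ZMod p), g • k • x = k • x := by
    intro g hg k
    have := hx (hN.conj_mem g hg k⁻¹)
    rwa [MulAction.mem_stabilizer_iff, mul_smul, mul_smul, inv_inv, inv_smul_eq_iff] at this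
  rw [Subgroup.eq_bot_iff_forall]
  intro g hg
  refine (isMoebiusAction_PSL hp).eq_one_of_three g x (h • x) ((h * h) • x) h1.symm ?_ h2.symm
    (hx hg) (key g hg h) (key g hg _)
  rw [mul_smul]
  exact fun e => h1 (smul_left_cancel h e).symm

/-- A nontrivial normal N fixes no point, so together with any nontrivial `upper b` it generates
everything. Hence the quotient by N is cyclic and N contains all commutators, among them `upper 3`;
so N is the whole group. -/
theorem isSimpleGroup_PSL (hp : 5 ≤ p) :
    IsSimpleGroup (ProjectiveSpecialLinearGroup (Fin 2) (ZMod p)) := by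
  have h2 : (2 : ZMod p) ≠ 0 := by
    exact_mod_cast ZMod.natCast_ne_zero_of_lt (p := p) (n := 2) (by norm_num) (by omega)
  have h3 : (3 : ZMod p) ≠ 0 := by
    exact_mod_cast ZMod.natCast_ne_zero_of_lt (p := p) (n := 3) (by norm_num) (by omega)
  have hne : toPSL (upper (1 : ZMod p)) ≠ 1 := fun h => by
    have := (toPSL_eq_one_iff.1 h).2.1
    simp at this
  have : Nontrivial (ProjectiveSpecialLinearGroup (Fin 2) (ZMod p)) := ⟨⟨_, _, hne⟩⟩
  refine ⟨fun N hN => or_iff_not_imp_left.2 fun hbot => ?_⟩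
  have key : ∀ b : ZMod p, b ≠ 0 → ∀ H, N ≤ H → toPSL (upper b) ∈ H → H = ⊤ := by
    intro b hb H hNH hbH
    refine (eq_top_or_le_stabilizer_infty hb hbH).resolve_right fun h => hbot ?_
    exact eq_bot_of_normal_of_le_stabilizer hp hN (hNH.trans h)
  have htop := key 1 one_ne_zero (N ⊔ Subgroup.zpowers (toPSL (upper 1))) le_sup_left
    (Subgroup.mem_sup_right (Subgroup.mem_zpowers _))
  have hz : Subgroup.zpowers (QuotientGroup.mk' N (toPSL (upper 1))) = ⊤ := by
    have h := congrArg (Subgroup.map (QuotientGroup.mk' N)) htop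
    rwa [Subgroup.map_sup, MonoidHom.map_zpowers,
      (Subgroup.map_eq_bot_iff N).2 (by rw [QuotientGroup.ker_mk']), bot_sup_eq,
      Subgroup.map_top_of_surjective _ (QuotientGroup.mk'_surjective N)] at h
  have hcomm : ∀ a b : ProjectiveSpecialLinearGroup (Fin 2) (ZMod p), a * b * a⁻¹ * b⁻¹ ∈ N := by
    intro a b
    rw [← QuotientGroup.eq_one_iff]
    change QuotientGroup.mk' N _ = 1
    obtain ⟨m, hm⟩ := Subgroup.mem_zpowers_iff.1 (hz ▸ Subgroup.mem_top (QuotientGroup.mk' N a))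
    obtain ⟨n, hn⟩ := Subgroup.mem_zpowers_iff.1 (hz ▸ Subgroup.mem_top (QuotientGroup.mk' N b))
    rw [map_mul, map_mul, map_mul, map_inv, map_inv, ← hm, ← hn]
    group
  refine key 3 h3 N le_rfl ?_
  have := hcomm (toPSL (slOf 2 0 0 (1 / 2) (by field_simp; ring))) (toPSL (upper 1))
  rw [← map_inv, ← map_inv, ← map_mul, ← map_mul, ← map_mul] at this
  convert this using 2
  rw [eq_mul_inv_iff_mul_eq, eq_mul_inv_iff_mul_eq]
  apply ext_fin_two <;> simp [mul_apply_fin_two]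
  field_simp
  ring

end PSL

/-! ### Automorphisms of PSL(2, p) -/

section PSL

open Matrix

open Matrix.SpecialLinearGroup (ext_fin_two mul_apply_fin_two inv_apply_fin_two det_eq_one_fin_two)

theorem exists_fixedForm_eq_zero_of_discr_eq_zero {K : Type*} [Field K] [NeZero (2 : K)]
    {A : Matrix (Fin 2) (Fin 2) K} (hA : A.discr = 0) : ∃ x : OnePoint K, fixedForm A x = 0 := by
  have h2 : (2 : K) ≠ 0 := NeZero.ne 2
  rw [discr_fin_two, trace_fin_two, det_fin_two] at hA
  by_cases hc : A 1 0 = 0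
  · exact ⟨OnePoint.infty, hc⟩
  · refine ⟨((A 0 0 - A 1 1) / (2 * A 1 0) : K), ?_⟩
    change A 1 0 * _ ^ 2 + (A 1 1 - A 0 0) * _ - A 0 1 = 0
    field_simp
    linear_combination -hA

variable {p : ℕ} [Fact p.Prime]

/-- `M` induces the automorphism `α` of `PSL(2, p)` by conjugation. -/
def Implements (M : GL (Fin 2) (ZMod p)) (α : ProjectiveSpecialLinearGroup (Fin 2) (ZMod p) ≃*
    ProjectiveSpecialLinearGroup (Fin 2) (ZMod p)) : Prop :=
  ∀ g : Matrix.SpecialLinearGroup (Fin 2) (ZMod p),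
    ∃ h : Matrix.SpecialLinearGroup (Fin 2) (ZMod p), α (toPSL g) = toPSL h ∧
      (M : Matrix (Fin 2) (Fin 2) (ZMod p)) * g = h * (M : Matrix (Fin 2) (Fin 2) (ZMod p))

theorem Implements.trans_conj {M : GL (Fin 2) (ZMod p)}
    {α : ProjectiveSpecialLinearGroup (Fin 2) (ZMod p) ≃*
      ProjectiveSpecialLinearGroup (Fin 2) (ZMod p)} (h : Implements M α)
    (s : Matrix.SpecialLinearGroup (Fin 2) (ZMod p)) :
    Implements (Matrix.SpecialLinearGroup.toGL s * M) (α.trans (MulAut.conj (toPSL s))) := by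
  intro g
  obtain ⟨k, hk, hM⟩ := h g
  refine ⟨s * k * s⁻¹, ?_, ?_⟩
  · rw [MulEquiv.trans_apply, hk, MulAut.conj_apply, map_mul, map_mul, map_inv]
  · rw [Units.val_mul, Matrix.mul_assoc, hM]
    change (s : Matrix (Fin 2) (Fin 2) (ZMod p)) * _ = _ * ((s : Matrix (Fin 2) (Fin 2) (ZMod p)) * _)
    rw [← Matrix.mul_assoc, ← Matrix.mul_assoc, ← Matrix.SpecialLinearGroup.coe_mul,
      ← Matrix.SpecialLinearGroup.coe_mul, inv_mul_cancel_right]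

theorem implements_of_upper_of_lower {M : GL (Fin 2) (ZMod p)}
    {α : ProjectiveSpecialLinearGroup (Fin 2) (ZMod p) ≃*
      ProjectiveSpecialLinearGroup (Fin 2) (ZMod p)} {u l : Matrix.SpecialLinearGroup (Fin 2) (ZMod p)}
    (hu : α (toPSL (upper 1)) = toPSL u) (hl : α (toPSL (lower 1)) = toPSL l)
    (hMu : M.1 * (upper (1 : ZMod p)).1 = u.1 * M.1)
    (hMl : M.1 * (lower (1 : ZMod p)).1 = l.1 * M.1) :
    Implements M α := by
  let H : Subgroup (ProjectiveSpecialLinearGroup (Fin 2) (ZMod p)) :=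
    { carrier := {x | ∃ g h : Matrix.SpecialLinearGroup (Fin 2) (ZMod p), x = toPSL g ∧
        α x = toPSL h ∧ M.1 * g.1 = h.1 * M.1}
      one_mem' := ⟨1, 1, by simp, by simp, by simp⟩
      mul_mem' := by
        rintro _ _ ⟨g, h, rfl, e, hM⟩ ⟨g', h', rfl, e', hM'⟩
        refine ⟨g * g', h * h', by rw [map_mul], by rw [map_mul, e, e', map_mul], ?_⟩
        rw [Matrix.SpecialLinearGroup.coe_mul, Matrix.SpecialLinearGroup.coe_mul,
          ← Matrix.mul_assoc, hM, Matrix.mul_assoc, hM', Matrix.mul_assoc]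
      inv_mem' := by
        rintro _ ⟨g, h, rfl, e, hM⟩
        refine ⟨g⁻¹, h⁻¹, by rw [map_inv], by rw [map_inv, e, map_inv], ?_⟩
        have h1 : (h⁻¹).1 * h.1 = 1 := by
          rw [← Matrix.SpecialLinearGroup.coe_mul, inv_mul_cancel, Matrix.SpecialLinearGroup.coe_one]
        have h2 : g.1 * (g⁻¹).1 = 1 := by
          rw [← Matrix.SpecialLinearGroup.coe_mul, mul_inv_cancel, Matrix.SpecialLinearGroup.coe_one]
        calc M.1 * (g⁻¹).1 = (h⁻¹).1 * (h.1 * M.1) * (g⁻¹).1 := by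
              rw [← Matrix.mul_assoc _ h.1, h1, Matrix.one_mul]
          _ = _ := by
              rw [← hM, ← Matrix.mul_assoc, Matrix.mul_assoc _ g.1, h2, Matrix.mul_one] }
  have hU : toPSL (upper (1 : ZMod p)) ∈ H := ⟨_, _, rfl, hu, hMu⟩
  have hL : toPSL (lower (1 : ZMod p)) ∈ H := ⟨_, _, rfl, hl, hMl⟩
  have htop : H = ⊤ := eq_top_of_upper_mem_of_lower_mem
    (upper_mem_of_upper_mem one_ne_zero hU) (lower_mem_of_lower_mem one_ne_zero hL)
  intro g
  obtain ⟨g', h, hg, hα, hM⟩ := (htop ▸ Subgroup.mem_top (toPSL g) : toPSL g ∈ H)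
  rcases toPSL_eq_iff.1 hg with rfl | rfl
  · exact ⟨h, hα, hM⟩
  · refine ⟨-h, hα.trans (toPSL_eq_iff.2 (Or.inr (neg_neg h).symm)), ?_⟩
    simp [hM]

/-- The relation that (upper 1 · lower (-1) · upper 1)² is trivial in PSL is preserved by α and
forces bd = 1. Then diag(b, 1) has the required effect on both generators. -/
theorem exists_implements_of_unitriangular (hp : 5 ≤ p)
    {α : ProjectiveSpecialLinearGroup (Fin 2) (ZMod p) ≃*
      ProjectiveSpecialLinearGroup (Fin 2) (ZMod p)} {b d : ZMod p}
    (hu : α (toPSL (upper 1)) = toPSL (upper b)) (hl : α (toPSL (lower 1)) = toPSL (lower d)) :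
    ∃ M, Implements M α := by
  have h2 : (2 : ZMod p) ≠ 0 := by
    exact_mod_cast ZMod.natCast_ne_zero_of_lt (p := p) (n := 2) (by norm_num) (by omega)
  have hd : d ≠ 0 := by
    rintro rfl
    have h0 : lower (0 : ZMod p) = 1 := by apply ext_fin_two <;> simp
    rw [h0, map_one, EmbeddingLike.map_eq_one_iff, toPSL_eq_one_iff] at hl
    simp at hl
  have hl' : α (toPSL (lower (-1))) = toPSL (lower (-d)) := by
    have e : ∀ t : ZMod p, lower (-t) = (lower t)⁻¹ := fun t => by
      rw [eq_inv_iff_mul_eq_one, lower_mul, neg_add_cancel]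
      apply ext_fin_two <;> simp
    rw [e, e, map_inv, map_inv, hl, map_inv]
  have hw : toPSL (upper (1 : ZMod p) * lower (-1) * upper 1 *
      (upper (1 : ZMod p) * lower (-1) * upper 1)) = 1 := by
    rw [toPSL_eq_one_iff]
    simp [mul_apply_fin_two]
  have hw' := congrArg α hw
  simp only [map_mul, map_one, hu, hl'] at hw'
  simp only [← map_mul] at hw'
  have hbd : b * d = 1 := by
    have h := (toPSL_eq_one_iff.1 hw').1
    simp only [mul_apply_fin_two, upper_zero_zero, upper_zero_one, upper_one_zero, upper_one_one,
      lower_zero_zero, lower_zero_one, lower_one_zero, lower_one_one] at h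
    have h' : (2 * d) * (b * d - 1) = 0 := by linear_combination h
    exact sub_eq_zero.1 ((mul_eq_zero.1 h').resolve_left (mul_ne_zero h2 hd))
  have hb : b ≠ 0 := left_ne_zero_of_mul_eq_one hbd
  refine ⟨GeneralLinearGroup.mkOfDetNeZero !![b, 0; 0, 1] (by simpa using hb),
    implements_of_upper_of_lower hu hl ?_ ?_⟩
  · ext i j
    fin_cases i <;> fin_cases j <;>
      simp [GeneralLinearGroup.mkOfDetNeZero, Matrix.mul_apply, Fin.sum_univ_two]
  · ext i j
    fin_cases i <;> fin_cases j <;>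
      simp [GeneralLinearGroup.mkOfDetNeZero, Matrix.mul_apply, Fin.sum_univ_two,
        mul_comm d b, hbd]

/-- Every automorphism of `PSL(2, p)` is induced by an element of `GL(2, p)`. -/
theorem exists_implements (hp : 5 ≤ p) (α : ProjectiveSpecialLinearGroup (Fin 2) (ZMod p) ≃*
    ProjectiveSpecialLinearGroup (Fin 2) (ZMod p)) : ∃ M, Implements M α := by
  have h2 : (2 : ZMod p) ≠ 0 := by
    exact_mod_cast ZMod.natCast_ne_zero_of_lt (p := p) (n := 2) (by norm_num) (by omega)
  have hdiscr : ∀ (β : ProjectiveSpecialLinearGroup (Fin 2) (ZMod p) ≃*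
      ProjectiveSpecialLinearGroup (Fin 2) (ZMod p)) (x g : Matrix.SpecialLinearGroup (Fin 2) (ZMod p)),
      β (toPSL x) = toPSL g → (x : Matrix (Fin 2) (Fin 2) (ZMod p)).discr = 0 →
      (g : Matrix (Fin 2) (Fin 2) (ZMod p)).discr = 0 := by
    intro β x g h hx
    rw [← toPSL_pow_eq_one_iff hp] at hx ⊢
    rw [← h, ← map_pow, hx, map_one]
  obtain ⟨g₁, hg₁⟩ := toPSL_surjective (α (toPSL (upper 1)))
  obtain ⟨s, b, hsb⟩ := exists_conj_eq_upper h2 (hdiscr α (upper 1) g₁ hg₁.symm (by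
    rw [discr_fin_two, trace_fin_two, det_fin_two]; simp; ring))
  let β := α.trans (MulAut.conj (toPSL s))
  have hβu : β (toPSL (upper 1)) = toPSL (upper b) := by
    rw [← hsb, map_mul, map_mul, map_inv, hg₁]
    rfl
  obtain ⟨g, hg⟩ := toPSL_surjective (β (toPSL (lower 1)))
  have hgd := hdiscr β (lower 1) g hg.symm (by
    rw [discr_fin_two, trace_fin_two, det_fin_two]; simp; ring)
  -- Otherwise β would carry a generating set into the stabilizer of ∞.
  have hc : g 1 0 ≠ 0 := by
    intro hc
    let B := (MulAction.stabilizer (ProjectiveSpecialLinearGroup (Fin 2) (ZMod p))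
      (OnePoint.infty : OnePoint (AlgebraicClosure (ZMod p)))).comap β.toMonoidHom
    have hU : toPSL (upper (1 : ZMod p)) ∈ B := by
      refine Subgroup.mem_comap.2 ?_
      change β _ ∈ _
      rw [hβu]
      exact toPSL_smul_infty_iff.2 rfl
    have hL : toPSL (lower (1 : ZMod p)) ∈ B := by
      refine Subgroup.mem_comap.2 ?_
      change β _ ∈ _
      rw [← hg]
      exact toPSL_smul_infty_iff.2 hc
    exact (Subgroup.isCoatom_comap_of_surjective β.surjective isCoatom_stabilizer_infty).1
      (eq_top_of_upper_mem_of_lower_mem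
        (upper_mem_of_upper_mem one_ne_zero hU) (lower_mem_of_lower_mem one_ne_zero hL))
  rw [discr_fin_two, trace_fin_two, det_fin_two] at hgd
  -- The fixed point of the unipotent g is z. Conjugation by `upper (-z)` moves it to 0 and leaves
  -- `upper b` unchanged.
  obtain ⟨z, hz⟩ : ∃ z, 2 * g 1 0 * z = g 0 0 - g 1 1 :=
    ⟨(g 0 0 - g 1 1) / (2 * g 1 0), by field_simp⟩
  have e : ∀ t : ZMod p, upper (-t) = (upper t)⁻¹ := fun t => by
    rw [eq_inv_iff_mul_eq_one, upper_mul, neg_add_cancel]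
    apply ext_fin_two <;> simp
  let δ := β.trans (MulAut.conj (toPSL (upper (-z))))
  have hδu : δ (toPSL (upper 1)) = toPSL (upper b) := by
    change toPSL (upper (-z)) * β (toPSL (upper 1)) * (toPSL (upper (-z)))⁻¹ = _
    rw [hβu, ← map_inv, ← map_mul, ← map_mul, ← e, upper_mul, upper_mul]
    congr 2
    ring
  obtain ⟨d, hδl⟩ : ∃ d, δ (toPSL (lower 1)) = toPSL (lower d) := by
    change ∃ d, toPSL (upper (-z)) * β (toPSL (lower 1)) * (toPSL (upper (-z)))⁻¹ = _
    rw [← hg, ← map_inv, ← map_mul, ← map_mul, ← e, neg_neg]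
    set k := upper (-z) * g * upper z with hk
    have k01 : k 0 1 = 0 := by
      have : (4 * g 1 0) * k 0 1 = 0 := by
        simp only [hk, mul_apply_fin_two, upper_zero_zero, upper_zero_one, upper_one_one]
        linear_combination (g 0 0 - g 1 1 - 2 * g 1 0 * z) * hz + hgd
      refine (mul_eq_zero.1 this).resolve_left (mul_ne_zero ?_ hc)
      have : (4 : ZMod p) = 2 * 2 := by norm_num
      rw [this]
      exact mul_ne_zero h2 h2
    have k00 : k 0 0 = k 1 1 := by
      simp only [hk, mul_apply_fin_two, upper_zero_zero, upper_zero_one, upper_one_zero,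
        upper_one_one]
      linear_combination -hz
    have hdet := det_eq_one_fin_two k
    rw [k01, ← k00] at hdet
    have : (k 0 0 - 1) * (k 0 0 + 1) = 0 := by linear_combination hdet
    rcases mul_eq_zero.1 this with h0 | h0
    · refine ⟨k 1 0, congrArg _ ?_⟩
      have e : k 0 0 = 1 := by linear_combination h0
      have e' : k 1 1 = 1 := by rw [← k00, e]
      apply ext_fin_two <;> simp [e, e', k01]
    · refine ⟨-k 1 0, toPSL_eq_iff.2 (Or.inr ?_)⟩
      have e : k 0 0 = -1 := by linear_combination h0
      have e' : k 1 1 = -1 := by rw [← k00, e]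
      apply ext_fin_two <;> simp [e, e', k01]
  obtain ⟨M, hM⟩ := exists_implements_of_unitriangular hp hδu hδl
  have hα : α = δ.trans (MulAut.conj (toPSL (upper (-z) * s)⁻¹)) := by
    ext1 x
    change _ = _ * (_ * (_ * α x * _) * _) * _
    simp only [map_mul, map_inv]
    group
  exact ⟨_, hα ▸ hM.trans_conj _⟩

end PSL

/-! ### Fixed-point subgroups of automorphisms -/

section PSL

open Matrix

variable {p : ℕ} [Fact p.Prime]

theorem Implements.apply_eq_self {M : GL (Fin 2) (ZMod p)}
    {γ : ProjectiveSpecialLinearGroup (Fin 2) (ZMod p) ≃*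
      ProjectiveSpecialLinearGroup (Fin 2) (ZMod p)} (h : Implements M γ)
    {g : Matrix.SpecialLinearGroup (Fin 2) (ZMod p)} (hg : M.1 * g.1 = g.1 * M.1) :
    γ (toPSL g) = toPSL g := by
  obtain ⟨k, hk, hM⟩ := h g
  have h1 : k.1 * M.1 = g.1 * M.1 := hM.symm.trans hg
  have h2 : k = g := Subtype.ext (M.isUnit.mul_right_cancel h1)
  rw [hk, h2]

theorem Implements.eq_refl {M : GL (Fin 2) (ZMod p)}
    {γ : ProjectiveSpecialLinearGroup (Fin 2) (ZMod p) ≃*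
      ProjectiveSpecialLinearGroup (Fin 2) (ZMod p)} (h : Implements M γ)
    (hM : M.1 1 0 = 0 ∧ M.1 0 1 = 0 ∧ M.1 0 0 = M.1 1 1) : γ = MulEquiv.refl _ := by
  ext1 x
  obtain ⟨g, rfl⟩ := toPSL_surjective x
  refine h.apply_eq_self ?_
  obtain ⟨h1, h2, h3⟩ := hM
  ext i j
  fin_cases i <;> fin_cases j <;>
    simp [Matrix.mul_apply, Fin.sum_univ_two, h1, h2, h3, mul_comm]

/-- The action of `GL(2, p)` on the projective line over the algebraic closure. -/
noncomputable def glSMul (M : GL (Fin 2) (ZMod p)) (x : OnePoint (AlgebraicClosure (ZMod p))) :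
    OnePoint (AlgebraicClosure (ZMod p)) := by
  classical
  exact M.map (algebraMap (ZMod p) (AlgebraicClosure (ZMod p))) • x

theorem glSMul_injective (M : GL (Fin 2) (ZMod p)) : Function.Injective (glSMul M) := by
  classical
  exact MulAction.injective _

theorem glSMul_eq_self_iff (M : GL (Fin 2) (ZMod p)) (x : OnePoint (AlgebraicClosure (ZMod p))) :
    glSMul M x = x ↔
      fixedForm (M.1.map (algebraMap (ZMod p) (AlgebraicClosure (ZMod p)))) x = 0 := by
  classical
  exact smul_eq_self_iff_fixedForm _ x

theorem Implements.glSMul_smul {M : GL (Fin 2) (ZMod p)}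
    {γ : ProjectiveSpecialLinearGroup (Fin 2) (ZMod p) ≃*
      ProjectiveSpecialLinearGroup (Fin 2) (ZMod p)} (h : Implements M γ)
    (y : ProjectiveSpecialLinearGroup (Fin 2) (ZMod p))
    (x : OnePoint (AlgebraicClosure (ZMod p))) : glSMul M (y • x) = γ y • glSMul M x := by
  classical
  obtain ⟨g, rfl⟩ := toPSL_surjective y
  obtain ⟨k, hk, hM⟩ := h g
  rw [hk]
  have e : M * Matrix.SpecialLinearGroup.toGL g = Matrix.SpecialLinearGroup.toGL k * M :=
    Units.ext hM
  have e' := congrArg (GeneralLinearGroup.map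
    (algebraMap (ZMod p) (AlgebraicClosure (ZMod p)))) e
  rw [map_mul, map_mul] at e'
  have := congrArg (fun N : GL (Fin 2) (AlgebraicClosure (ZMod p)) => N • x) e'
  simp only [mul_smul] at this
  exact this

/-- A γ-fixed element commutes with M on the line, so it permutes the fixed points of M. If M has
one fixed point, the subgroup is the unipotent group there; if two, it lies between the pointwise
and the setwise stabilizer of the pair. -/
theorem Implements.isGeometric_fixedSubgroup (hp : 5 ≤ p) {M : GL (Fin 2) (ZMod p)}
    {γ : ProjectiveSpecialLinearGroup (Fin 2) (ZMod p) ≃*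
      ProjectiveSpecialLinearGroup (Fin 2) (ZMod p)} (h : Implements M γ)
    (hγ : γ ≠ MulEquiv.refl _) :
    IsGeometric p (OnePoint (AlgebraicClosure (ZMod p))) γ.fixedSubgroup := by
  have h2 := neZero_two_of_le hp
  have hact := isMoebiusAction_PSL (p := p) hp
  have inj := (algebraMap (ZMod p) (AlgebraicClosure (ZMod p))).injective
  have hscalar : ∀ x y z : OnePoint (AlgebraicClosure (ZMod p)), x ≠ y → y ≠ z → x ≠ z →
      glSMul M x = x → glSMul M y = y → glSMul M z ≠ z := by
    intro x y z hxy hyz hxz hx hy hz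
    rw [glSMul_eq_self_iff] at hx hy hz
    obtain ⟨a, b, c⟩ := fixedForm_eq_zero_of_three hxy hyz hxz hx hy hz
    exact hγ (h.eq_refl ⟨(map_eq_zero_iff _ inj).1 a, (map_eq_zero_iff _ inj).1 b, inj c⟩)
  have hcomm : ∀ g : Matrix.SpecialLinearGroup (Fin 2) (ZMod p),
      M.1.map (algebraMap (ZMod p) (AlgebraicClosure (ZMod p))) *
        g.1.map (algebraMap (ZMod p) (AlgebraicClosure (ZMod p))) =
      g.1.map (algebraMap (ZMod p) (AlgebraicClosure (ZMod p))) *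
        M.1.map (algebraMap (ZMod p) (AlgebraicClosure (ZMod p))) → toPSL g ∈ γ.fixedSubgroup := by
    intro g hg
    rw [← Matrix.map_mul, ← Matrix.map_mul] at hg
    exact h.apply_eq_self (Matrix.map_injective inj hg)
  have hfix : ∀ y ∈ γ.fixedSubgroup, ∀ x, glSMul M x = x → glSMul M (y • x) = y • x := by
    intro y hy x hx
    rw [h.glSMul_smul, MulEquiv.mem_fixedSubgroup.1 hy, hx]
  have hfix' : ∀ y ∈ γ.fixedSubgroup, ∀ x : OnePoint (AlgebraicClosure (ZMod p)), y • x = x →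
      y • glSMul M x = glSMul M x := by
    intro y hy x hx
    have := h.glSMul_smul y x
    rwa [MulEquiv.mem_fixedSubgroup.1 hy, hx, eq_comm] at this
  by_cases hd : M.1.discr = 0
  · have hd' : (M.1.map (algebraMap (ZMod p) (AlgebraicClosure (ZMod p)))).discr = 0 := by
      rw [discr_map_algebraMap, hd, map_zero]
    obtain ⟨x, hx⟩ := exists_fixedForm_eq_zero_of_discr_eq_zero hd'
    have huniq : ∀ z, glSMul M z = z → z = x := by
      intro z hz
      by_contra hne
      rw [glSMul_eq_self_iff] at hz
      obtain ⟨a, b, c⟩ := eq_of_discr_eq_zero hd' hne hz hx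
      exact hγ (h.eq_refl ⟨(map_eq_zero_iff _ inj).1 a, (map_eq_zero_iff _ inj).1 b, inj c⟩)
    have hxM := (glSMul_eq_self_iff M x).2 hx
    refine Or.inr (Or.inr ⟨x, fun y => ⟨fun hy => ?_, fun hy => ?_⟩⟩)
    · have hyx : y • x = x := huniq _ (hfix y hy x hxM)
      refine ⟨hyx, ?_⟩
      by_contra hyp
      -- A non-unipotent y would fix some z ≠ x, hence also M z, giving three distinct fixed points.
      obtain ⟨z, hzx, hz⟩ : ∃ z, z ≠ x ∧ y • z = z := by
        obtain ⟨u, v, huv, hu, hv⟩ := hact.exists_two y hyp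
        by_cases e : u = x
        · exact ⟨v, fun e' => huv (e.trans e'.symm), hv⟩
        · exact ⟨u, e, hu⟩
      have hMz := hfix' y hy z hz
      have hy1 : y ≠ 1 := by
        rintro rfl
        exact hyp (one_pow p)
      refine hy1 (hact.eq_one_of_three y x z (glSMul M z) hzx.symm ?_ ?_ hyx hz hMz)
      · exact fun e => hzx (huniq z e.symm)
      · intro e
        exact hzx (glSMul_injective M (e.symm.trans hxM.symm))
    · obtain ⟨g, rfl⟩ := toPSL_surjective y
      rw [toPSL_smul_eq_self_iff, toPSL_pow_eq_one_iff hp] at hy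
      exact hcomm g (commute_of_discr_eq_zero hx hy.1 hd'
        (by rw [discr_map_algebraMap, hy.2, map_zero]))
  · obtain ⟨x, y, hxy, hx, hy⟩ := exists_two_of_discr_ne_zero
      (A := M.1.map (algebraMap (ZMod p) (AlgebraicClosure (ZMod p))))
      (by rw [discr_map_algebraMap, map_ne_zero_iff _ inj]; exact hd)
    have hxM := (glSMul_eq_self_iff M x).2 hx
    have hyM := (glSMul_eq_self_iff M y).2 hy
    have hor : ∀ z, glSMul M z = z → z = x ∨ z = y := by
      intro z hz
      by_contra! hne
      exact hscalar x y z hxy hne.2.symm hne.1.symm hxM hyM hz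
    have hT : ∀ g : ProjectiveSpecialLinearGroup (Fin 2) (ZMod p), g • x = x → g • y = y →
        g ∈ γ.fixedSubgroup := by
      intro g hgx hgy
      obtain ⟨g, rfl⟩ := toPSL_surjective g
      rw [toPSL_smul_eq_self_iff] at hgx hgy
      exact hcomm g (commute_of_two hxy hx hy hgx hgy)
    have hN : ∀ g ∈ γ.fixedSubgroup, (g • x = x ∧ g • y = y) ∨ (g • x = y ∧ g • y = x) := by
      intro g hg
      have hne : g • x ≠ g • y := fun e => hxy (smul_left_cancel g e)
      rcases hor _ (hfix g hg x hxM) with h1 | h1 <;> rcases hor _ (hfix g hg y hyM) with h3 | h3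
      · exact absurd (h1.trans h3.symm) hne
      · exact Or.inl ⟨h1, h3⟩
      · exact Or.inr ⟨h1, h3⟩
      · exact absurd (h1.trans h3.symm) hne
    refine Or.inr (Or.inl ⟨x, y, hxy, ?_⟩)
    -- The pointwise stabilizer has index at most two in the setwise one, so a single swapping
    -- element decides between them.
    by_cases hswap : ∃ k ∈ γ.fixedSubgroup, k • x = y ∧ k • y = x
    · left
      obtain ⟨k, hk, hkx, hky⟩ := hswap
      ext g
      rw [mem_stabilizer_pair_iff]
      refine ⟨hN g, ?_⟩
      rintro (hg | hg)
      · exact hT g hg.1 hg.2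
      · have : g * k ∈ γ.fixedSubgroup := hT _ (by rw [mul_smul, hkx, hg.2])
          (by rw [mul_smul, hky, hg.1])
        exact (Subgroup.mul_mem_cancel_right _ hk).1 this
    · right
      ext g
      rw [Subgroup.mem_inf, MulAction.mem_stabilizer_iff, MulAction.mem_stabilizer_iff]
      refine ⟨fun hg => ?_, fun hg => hT g hg.1 hg.2⟩
      exact (hN g hg).resolve_right fun h => hswap ⟨g, hg, h⟩

end PSL

theorem proposition2p7 (p : ℕ) [Fact p.Prime] (hp : 5 ≤ p) :
    maxDim (Matrix.ProjectiveSpecialLinearGroup (Fin 2) (ZMod p) ×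
        Matrix.ProjectiveSpecialLinearGroup (Fin 2) (ZMod p)) =
      2 * maxDim (Matrix.ProjectiveSpecialLinearGroup (Fin 2) (ZMod p)) ∧
    maxDim (Matrix.ProjectiveSpecialLinearGroup (Fin 2) (ZMod p)) ≤ 4 := by
  have hp' : p.Prime := Fact.out
  have hodd : Odd p := hp'.odd_of_ne_two (by omega)
  have hsimple := isSimpleGroup_PSL hp
  have hact := isMoebiusAction_PSL hp
  refine ⟨hact.maxDim_prod hp' hodd (three_le_maxDim_PSL hp) fun γ hγ => ?_,
    hact.maxDim_le_four hp' hodd⟩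
  obtain ⟨M, hM⟩ := exists_implements hp γ
  exact hM.isGeometric_fixedSubgroup hp hγ
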